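/- Let $n\ge 1$, $s\in\mathbb R$ and $m^2\in\mathbb R$ (of either sign). Let $$A(x,\partial_x)=\sum_{i,j=1}^n a_{ij}(x)\,\partial_i\partial_j+\sum_{j=1}^n b_j(x)\,\partial_j+c(x)$$ be a second order differential operator on $\mathbb R^n$ whose coefficients are $C^\infty$ functions with bounded derivatives of every order $k\ge 0$ ($a_{ij}$ real-valued, $b_j$ and $c$ possibly complex-valued), and assume that $A$ is negative and uniformly elliptic: there is $\delta>0$ with $\sum_{i,j}a_{ij}(x)\xi_i\xi_j\ge\delta|\xi|^2$ for all $x,\xi\in\mathbb R^n$. Let $H_{(s)}=H_{(s)}(\mathbb R^n)$ denote the $L^2$-based Sobolev space of order $s$. Then there is a number $C>0$, depending only on $n$, $A$, $m^2$ and $s$, such that for all $\psi_0\in H_{(s+1)}$, $\psi_1\in H_{(s)}$, every solution $$\psi\in C([0,\infty);H_{(s+1)})\cap C^1([0,\infty);H_{(s)})\cap C^2([0,\infty);H_{(s-1)})$$ of the Cauchy problem $$\psi_{tt}+n\,\psi_t-e^{-2t}A(x,\partial_x)\psi+m^2\psi=0,\qquad \psi(0)=\psi_0,\quad \psi_t(0)=\psi_1,$$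 satisfies, for all $t>0$, $$\|\psi_t(t)\|_{H_{(s)}}+e^{-t}\|\psi(t)\|_{H_{(s+1)}}\le C\left(\|\psi(t)\|_{H_{(s)}}+e^{-\frac n2 t}\|\psi_1\|_{H_{(s)}}+e^{-\frac n2 t}\|\psi_0\|_{H_{(s+1)}}\right).$$ -/

import Mathlib

noncomputable section

namespace DeSitterKG

open MeasureTheory Filter Topology

/-- The space `ℝⁿ` with its Euclidean norm. -/
abbrev Space (n : ℕ) : Type := EuclideanSpace ℝ (Fin n)

/-- Complex-valued tempered distributions on `ℝⁿ`. -/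
abbrev Dist (n : ℕ) : Type := TemperedDistribution (Space n) ℂ

/-- The Hilbert space `L²(ℝⁿ; ℂ)`. -/
abbrev L2 (n : ℕ) : Type := Lp ℂ 2 (volume : Measure (Space n))

/-! ### Coefficients -/

/-- The class `𝓑^∞`: smooth functions on `ℝⁿ` all of whose derivatives (of every order `k ≥ 0`)
are bounded on `ℝⁿ`. -/
def IsBInfty {n : ℕ} {F : Type*} [NormedAddCommGroup F] [NormedSpace ℝ F]
    (f : Space n → F) : Prop :=
  ContDiff ℝ (⊤ : ℕ∞) f ∧ ∀ k : ℕ, ∃ C : ℝ, ∀ x : Space n, ‖iteratedFDeriv ℝ k f x‖ ≤ C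

/-- Functions of class `𝓑^∞` have temperate growth, so that they multiply tempered
distributions. -/
theorem IsBInfty.hasTemperateGrowth {n : ℕ} {F : Type*} [NormedAddCommGroup F] [NormedSpace ℝ F]
    {f : Space n → F} (hf : IsBInfty f) : f.HasTemperateGrowth := by
  refine ⟨hf.1, fun k => ?_⟩
  obtain ⟨C, hC⟩ := hf.2 k
  exact ⟨0, C, fun x => by simpa using hC x⟩

/-- The coefficients of a linear differential operator of order two on `ℝⁿ`,
`A(x, ∂ₓ) = ∑_{i,j} a i j (x) ∂_i ∂_j + ∑_j b j (x) ∂_j + c(x)`. -/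
structure SecondOrderOp (n : ℕ) where
  /-- the coefficients of second order -/
  a : Fin n → Fin n → Space n → ℝ
  /-- the coefficients of first order -/
  b : Fin n → Space n → ℂ
  /-- the coefficient of order zero -/
  c : Space n → ℂ

/-- All coefficients of `A` belong to `𝓑^∞`. -/
structure SecondOrderOp.HasBInftyCoeffs {n : ℕ} (A : SecondOrderOp n) : Prop where
  a : ∀ i j, IsBInfty (A.a i j)
  b : ∀ j, IsBInfty (A.b j)
  c : IsBInfty A.c

/-- `A` is negative and uniformly elliptic: its principal symbol `-∑ a i j (x) ξ_i ξ_j`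
is at most `-δ |ξ|²` for some `δ > 0` and all `x`, `ξ`. -/
def SecondOrderOp.IsNegativeElliptic {n : ℕ} (A : SecondOrderOp n) : Prop :=
  ∃ δ : ℝ, 0 < δ ∧ ∀ x ξ : Space n,
    -(∑ i, ∑ j, A.a i j x * ξ i * ξ j) ≤ -(δ * ‖ξ‖ ^ 2)

/-- The partial derivative `∂_i` of tempered distributions. -/
def pderiv {n : ℕ} (i : Fin n) (u : Dist n) : Dist n :=
  LineDeriv.lineDerivOp (EuclideanSpace.single i (1 : ℝ) : Space n) u

/-- The action of `A` on tempered distributions. -/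
def SecondOrderOp.apply {n : ℕ} (A : SecondOrderOp n) (u : Dist n) : Dist n :=
  (∑ i, ∑ j, TemperedDistribution.smulLeftCLM ℂ (fun x => (A.a i j x : ℂ))
      (pderiv i (pderiv j u)))
    + (∑ j, TemperedDistribution.smulLeftCLM ℂ (A.b j) (pderiv j u))
    + TemperedDistribution.smulLeftCLM ℂ A.c u

/-! ### Sobolev spaces -/

/-- `f ∈ L²` represents the element `u` of `H_(s)(ℝⁿ)`: it is the image of `u` under the Bessel
potential `(1 + |ξ|²)^(s/2)`, an isometric isomorphism from `H_(s)` onto `L²`. -/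
def SobolevRep {n : ℕ} (s : ℝ) (u : Dist n) (f : L2 n) : Prop :=
  TemperedDistribution.besselPotential (Space n) ℂ s u = Lp.toTemperedDistribution f

open Classical in
/-- The norm of `H_(s)(ℝⁿ)`, with the value `0` outside `H_(s)(ℝⁿ)`. -/
def sobolevNorm {n : ℕ} (s : ℝ) (u : Dist n) : ℝ :=
  if h : TemperedDistribution.MemSobolev s 2 u then ‖h.choose‖ else 0

theorem SobolevRep.unique {n : ℕ} {s : ℝ} {u : Dist n} {f g : L2 n}
    (hf : SobolevRep s u f) (hg : SobolevRep s u g) : f = g := by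
  have h : Lp.toTemperedDistribution f = Lp.toTemperedDistribution g := hf.symm.trans hg
  have hk := Lp.ker_toTemperedDistributionCLM_eq_bot (F := ℂ)
    (μ := (volume : Measure (Space n))) (p := 2)
  exact LinearMap.ker_eq_bot.1 hk h

theorem SobolevRep.sobolevNorm_eq {n : ℕ} {s : ℝ} {u : Dist n} {f : L2 n}
    (hf : SobolevRep s u f) : sobolevNorm s u = ‖f‖ := by
  have h : TemperedDistribution.MemSobolev s 2 u := ⟨f, hf⟩
  have h2 : SobolevRep s u h.choose := h.choose_spec
  rw [sobolevNorm, dif_pos h, h2.unique hf]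

/-- `u ∈ C(I; H_(s)(ℝⁿ))`. -/
def ContinuousInSobolev {n : ℕ} (s : ℝ) (I : Set ℝ) (u : ℝ → Dist n) : Prop :=
  ∃ f : ℝ → L2 n, (∀ t ∈ I, SobolevRep s (u t) (f t)) ∧ ContinuousOn f I

/-- The function `u : I → H_(s)(ℝⁿ)` is differentiable on `I` in the norm of `H_(s)(ℝⁿ)`, with
derivative `u'`. -/
def HasDerivInSobolev {n : ℕ} (s : ℝ) (I : Set ℝ) (u u' : ℝ → Dist n) : Prop :=
  ∃ f f' : ℝ → L2 n, (∀ t ∈ I, SobolevRep s (u t) (f t)) ∧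
    (∀ t ∈ I, SobolevRep s (u' t) (f' t)) ∧ ∀ t ∈ I, HasDerivWithinAt f (f' t) I t

/-! ### The Cauchy problem -/

/-- `ψ`, with time derivatives `ψt` and `ψtt`, is an energy solution at regularity `s` of
`ψ_tt + n ψ_t - e^{-2t} A(x, ∂ₓ) ψ + m² ψ = 0`, `ψ(0) = ψ₀`, `ψ_t(0) = ψ₁` on `[0, ∞)`:
`ψ ∈ C([0,∞); H_(s+1)) ∩ C¹([0,∞); H_(s)) ∩ C²([0,∞); H_(s-1))`, and the equation holds at every
time `t ≥ 0`. The real number `m2` stands for `m²` and may have either sign. -/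
structure IsEnergySolution {n : ℕ} (A : SecondOrderOp n) (m2 s : ℝ) (ψ₀ ψ₁ : Dist n)
    (ψ ψt ψtt : ℝ → Dist n) : Prop where
  continuous : ContinuousInSobolev (s + 1) (Set.Ici 0) ψ
  hasDeriv : HasDerivInSobolev s (Set.Ici 0) ψ ψt
  continuous_deriv : ContinuousInSobolev s (Set.Ici 0) ψt
  hasDeriv_deriv : HasDerivInSobolev (s - 1) (Set.Ici 0) ψt ψtt
  continuous_deriv_deriv : ContinuousInSobolev (s - 1) (Set.Ici 0) ψtt
  equation : ∀ t : ℝ, 0 ≤ t →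
    ψtt t + (n : ℂ) • ψt t - (Real.exp (-2 * t) : ℂ) • A.apply (ψ t) + (m2 : ℂ) • ψ t = 0
  initial : ψ 0 = ψ₀
  initial_deriv : ψt 0 = ψ₁

end DeSitterKG

end

/-! Write Λ² = `bessel n 2`, the Fourier multiplier with symbol 1+|ξ|².

At the level of L² the estimate is an energy argument. The substitution u = e^{nt/2}ψ removes the
damping and gives u'' = e^{-2t}Au + μu with μ = n²/4 − m²; undoing it produces the factors e^{-nt/2}
in front of the data. Let q be the Dirichlet form of the principal part. The energy ‖u'‖² +
e^{-2t}(q + ‖u‖²) − μ‖u‖² has derivative at most e^{-2t}(−(q + ‖u‖²) + const·‖u'‖²): differentiating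
e^{-2t} gives a term of good sign that absorbs the first order part of A, and the rest carries an
integrable weight. If μ ≤ 0, Gronwall concludes. If μ > 0 the energy is indefinite; a small multiple
of e^{-αt}⟨u,u'⟩ is then subtracted, which absorbs ‖u'‖² for large times, and μ‖u‖² is moved to the
right-hand side, where ‖ψ(t)‖ is allowed (`exists_energy_bound`, `exists_hilbert_energy_bound`,
`exists_damped_energy_bound`).

For real s, conjugating by Λ^s would call for a pseudodifferential calculus. Instead the equation is
hit with P_l = (l+Λ²)^{-2}Λ^{2k}, with l ≥ 0 and a fixed integer k. Operators between Sobolev spaces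
of integer index form a filtered algebra, in which Leibniz and commutator identities yield P_l A =
(A + B_l)P_l, where B_l : H_(1) → L² is bounded uniformly in l (`IsDiffLike.exists_freqOp_mul`).
Hence P_lψ obeys the L² energy estimate with a constant independent of l
(`exists_freq_energy_bound`).

Finally, the integral over l > 0 of l^{s-2k+3} times the squared symbol of P_lΛ^{-s} is a positive
constant independent of ξ. Integrating the quadratic estimates over l therefore recovers exactly the
squared norms of H_(s) and H_(s+1) (`integral_norm_sq_freq`, `exists_sobolev_energy_bound`). -/

noncomputable section

/-! ### L² multipliers and bounded operators between Sobolev spaces. -/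

namespace DeSitterKG

open MeasureTheory Filter Topology TemperedDistribution FourierTransform
open scoped SchwartzMap ENNReal

/-! ### Multiplication operators and Fourier multipliers on `L²` -/

/-- Continuous linear operators on tempered distributions. -/
abbrev DistOp (n : ℕ) : Type := Dist n →L[ℂ] Dist n

/-- The Bessel potential of order `s`. -/
abbrev bessel (n : ℕ) (s : ℝ) : DistOp n := besselPotential (Space n) ℂ s

/-- Multiplication by a function. -/
abbrev mulOp {n : ℕ} (a : Space n → ℂ) : DistOp n := smulLeftCLM ℂ a

/-- The Fourier multiplier with a given symbol. -/
abbrev fourierOp {n : ℕ} (m : Space n → ℂ) : DistOp n := fourierMultiplierCLM ℂ m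

/-- The embedding of `L²` into tempered distributions. -/
abbrev toDist (n : ℕ) : L2 n →L[ℂ] Dist n := Lp.toTemperedDistributionCLM ℂ volume 2

theorem toDist_injective (n : ℕ) : Function.Injective (toDist n) :=
  LinearMap.ker_eq_bot.1 (Lp.ker_toTemperedDistributionCLM_eq_bot (F := ℂ)
    (μ := (volume : Measure (Space n))) (p := 2))

theorem memLp_top_of_bound {n : ℕ} {a : Space n → ℂ} (ha : a.HasTemperateGrowth) {C : ℝ}
    (hC : ∀ x, ‖a x‖ ≤ C) : MemLp a ∞ (volume : Measure (Space n)) :=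
  MeasureTheory.memLp_top_of_bound ha.1.continuous.aestronglyMeasurable C (Eventually.of_forall hC)

/-- Multiplication by a bounded function of temperate growth is bounded on `L²`. -/
theorem exists_mulL2 {n : ℕ} {a : Space n → ℂ} (ha : a.HasTemperateGrowth) {C : ℝ}
    (hC : ∀ x, ‖a x‖ ≤ C) :
    ∃ L : L2 n →L[ℂ] L2 n, ‖L‖ ≤ C ∧ (∀ f, mulOp a (toDist n f) = toDist n (L f)) ∧
      ∀ f, (L f : Space n → ℂ) =ᵐ[volume] fun x => a x * f x := by
  have hm := memLp_top_of_bound ha hC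
  have hae : ∀ f : L2 n, ((hm.toLp a • f : L2 n) : Space n → ℂ) =ᵐ[volume]
      fun x => a x * f x := by
    intro f
    filter_upwards [Lp.coeFn_lpSMul (r := 2) (hm.toLp a) f, hm.coeFn_toLp] with x h1 h2
    simp [h1, h2]
  have hC0 : 0 ≤ C := (norm_nonneg _).trans (hC 0)
  obtain ⟨L, hL⟩ : ∃ L : L2 n →L[ℂ] L2 n, ∀ f : L2 n, L f = (hm.toLp a • f : L2 n) :=
    ⟨(ContinuousLinearMap.lsmul ℂ ℂ (E := ℂ)).holderL volume ∞ 2 2 (hm.toLp a), fun f => rfl⟩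
  refine ⟨L, ContinuousLinearMap.opNorm_le_bound _ hC0 fun f => ?_, fun f => ?_, fun f => ?_⟩
  · refine Lp.norm_le_mul_norm_of_ae_le_mul ?_
    rw [hL]
    filter_upwards [hae f] with x hx
    rw [hx, norm_mul]
    gcongr
    exact hC x
  · rw [hL]
    exact (Lp.toTemperedDistribution_smul_eq ha hm f).symm
  · rw [hL]
    exact hae f

/-- Fourier multipliers with a bounded symbol are bounded on `L²`. -/
theorem exists_fourierL2 {n : ℕ} {m : Space n → ℂ} (hm : m.HasTemperateGrowth) {C : ℝ}
    (hC : ∀ x, ‖m x‖ ≤ C) :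
    ∃ L : L2 n →L[ℂ] L2 n, ‖L‖ ≤ C ∧ (∀ f, fourierOp m (toDist n f) = toDist n (L f)) ∧
      ∀ f, ((𝓕 (L f) : L2 n) : Space n → ℂ) =ᵐ[volume] fun x => m x * (𝓕 f : L2 n) x := by
  obtain ⟨L, hL1, hL2, hL3⟩ := exists_mulL2 hm hC
  have hC0 : 0 ≤ C := (norm_nonneg _).trans (hC 0)
  refine ⟨((Lp.fourierTransformₗᵢ (Space n) ℂ).symm : L2 n →L[ℂ] L2 n) ∘L L ∘L
    (Lp.fourierTransformₗᵢ (Space n) ℂ : L2 n →L[ℂ] L2 n), ?_, ?_, ?_⟩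
  · refine ContinuousLinearMap.opNorm_le_bound _ hC0 fun f => ?_
    have : ‖L (Lp.fourierTransformₗᵢ (Space n) ℂ f)‖ ≤ C * ‖f‖ := by
      refine (L.le_of_opNorm_le hL1 _).trans ?_
      rw [LinearIsometryEquiv.norm_map]
    simpa using this
  · intro f
    rw [fourierMultiplierCLM_apply, Lp.toTemperedDistributionCLM_apply,
      Lp.fourier_toTemperedDistribution_eq, ← Lp.toTemperedDistributionCLM_apply, hL2,
      Lp.toTemperedDistributionCLM_apply, Lp.fourierInv_toTemperedDistribution_eq]
    rfl
  · intro f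
    have hL3' := hL3 (𝓕 f)
    have h : 𝓕 (((Lp.fourierTransformₗᵢ (Space n) ℂ).symm : L2 n →L[ℂ] L2 n)
        (L (Lp.fourierTransformₗᵢ (Space n) ℂ f))) = L (𝓕 f) :=
      FourierTransform.fourier_fourierInv_eq (L (𝓕 f))
    rw [← h] at hL3'
    exact hL3'

/-! ### Operators bounded between Sobolev spaces -/

/-- `T` maps `H_(r)` to `H_(q)` with norm at most `C`. -/
def BddOp {n : ℕ} (r q : ℝ) (T : DistOp n) (C : ℝ) : Prop :=
  ∃ L : L2 n →L[ℂ] L2 n, ‖L‖ ≤ C ∧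
    ∀ f, bessel n q (T (bessel n (-r) (toDist n f))) = toDist n (L f)

theorem BddOp.exists_rep {n : ℕ} {r q : ℝ} {T : DistOp n} {C : ℝ} (h : BddOp r q T C) :
    ∃ L : L2 n →L[ℂ] L2 n, ‖L‖ ≤ C ∧ ∀ u f, SobolevRep r u f → SobolevRep q (T u) (L f) := by
  obtain ⟨L, hL, h⟩ := h
  refine ⟨L, hL, fun u f hu => ?_⟩
  have : u = bessel n (-r) (toDist n f) := by
    rw [Lp.toTemperedDistributionCLM_apply, ← hu]; simp
  rw [SobolevRep, this, h]
  rfl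

theorem BddOp.nonneg {n : ℕ} {r q : ℝ} {T : DistOp n} {C : ℝ} (h : BddOp r q T C) : 0 ≤ C := by
  obtain ⟨L, hL, -⟩ := h
  exact (norm_nonneg _).trans hL

theorem BddOp.mono {n : ℕ} {r q : ℝ} {T : DistOp n} {C D : ℝ} (h : BddOp r q T C) (hCD : C ≤ D) :
    BddOp r q T D := by
  obtain ⟨L, hL, h⟩ := h
  exact ⟨L, hL.trans hCD, h⟩

theorem BddOp.mul {n : ℕ} {r q p : ℝ} {S T : DistOp n} {C D : ℝ} (hS : BddOp q p S D)
    (hT : BddOp r q T C) : BddOp r p (S * T) (D * C) := by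
  obtain ⟨L, hL, h⟩ := hT
  obtain ⟨M, hM, h'⟩ := hS
  refine ⟨M * L, (norm_mul_le _ _).trans (by gcongr; exact (norm_nonneg _).trans hM), fun f => ?_⟩
  have := h' (L f)
  rw [← h f] at this
  simpa using this

theorem BddOp.add {n : ℕ} {r q : ℝ} {S T : DistOp n} {C D : ℝ} (hS : BddOp r q S C)
    (hT : BddOp r q T D) : BddOp r q (S + T) (C + D) := by
  obtain ⟨L, hL, h⟩ := hS
  obtain ⟨M, hM, h'⟩ := hT
  refine ⟨L + M, (norm_add_le _ _).trans (by gcongr), fun f => ?_⟩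
  simp only [_root_.add_apply, map_add, h, h']

theorem BddOp.smul {n : ℕ} {r q : ℝ} {S : DistOp n} {C : ℝ} (hS : BddOp r q S C) (c : ℂ) :
    BddOp r q (c • S) (‖c‖ * C) := by
  obtain ⟨L, hL, h⟩ := hS
  refine ⟨c • L, (norm_smul_le c L).trans (by gcongr), fun f => ?_⟩
  simp only [_root_.smul_apply, map_smul, h]

theorem BddOp.neg {n : ℕ} {r q : ℝ} {S : DistOp n} {C : ℝ} (hS : BddOp r q S C) :
    BddOp r q (-S) C := by
  simpa using hS.smul (-1)

theorem BddOp.sub {n : ℕ} {r q : ℝ} {S T : DistOp n} {C D : ℝ} (hS : BddOp r q S C)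
    (hT : BddOp r q T D) : BddOp r q (S - T) (C + D) := by
  rw [sub_eq_add_neg]; exact hS.add hT.neg

theorem BddOp.sum {n : ℕ} {r q : ℝ} {ι : Type*} (s : Finset ι) {S : ι → DistOp n} {C : ι → ℝ}
    (hS : ∀ i, BddOp r q (S i) (C i)) : BddOp r q (∑ i ∈ s, S i) (∑ i ∈ s, C i) := by
  classical
  induction s using Finset.induction_on with
  | empty => exact ⟨0, by simp, fun f => by
      simp only [Finset.sum_empty, _root_.zero_apply, map_zero]⟩
  | insert i s hi ih => rw [Finset.sum_insert hi, Finset.sum_insert hi]; exact (hS i).add ih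

theorem bessel_mul_bessel (n : ℕ) (r s : ℝ) : bessel n r * bessel n s = bessel n (r + s) := by
  ext1 u
  simp [add_comm]

theorem bessel_zero (n : ℕ) : bessel n 0 = 1 := by
  ext1 u
  simp

theorem bddOp_mulOp_zero {n : ℕ} {a : Space n → ℂ} (ha : a.HasTemperateGrowth) {C : ℝ}
    (hC : ∀ x, ‖a x‖ ≤ C) : BddOp 0 0 (mulOp a) C := by
  obtain ⟨L, hL, h, -⟩ := exists_mulL2 ha hC
  exact ⟨L, hL, fun f => by simpa using h f⟩

theorem fourierOp_mul {n : ℕ} {m₁ m₂ : Space n → ℂ} (h₁ : m₁.HasTemperateGrowth)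
    (h₂ : m₂.HasTemperateGrowth) : fourierOp m₁ * fourierOp m₂ = fourierOp (m₁ * m₂) := by
  ext1 u
  change fourierOp m₁ (fourierOp m₂ u) = _
  rw [fourierMultiplierCLM_fourierMultiplierCLM_apply h₂ h₁,
    mul_comm]

/-- The symbol of the Bessel potential of order `s`. -/
def besselSymbol (n : ℕ) (s : ℝ) (x : Space n) : ℂ := ((1 + ‖x‖ ^ 2) ^ (s / 2) : ℝ)

@[fun_prop]
theorem besselSymbol_hasTemperateGrowth (n : ℕ) (s : ℝ) :
    (besselSymbol n s).HasTemperateGrowth := by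
  unfold besselSymbol
  fun_prop

theorem bessel_eq (n : ℕ) (s : ℝ) : bessel n s = fourierOp (besselSymbol n s) := rfl

theorem norm_besselSymbol (n : ℕ) (s : ℝ) (x : Space n) :
    ‖besselSymbol n s x‖ = (1 + ‖x‖ ^ 2) ^ (s / 2) := by
  rw [besselSymbol, Complex.norm_real, Real.norm_of_nonneg (by positivity)]

theorem bddOp_fourierOp {n : ℕ} {m : Space n → ℂ} (hm : m.HasTemperateGrowth) {r q C : ℝ}
    (hC : ∀ x, ‖m x‖ * (1 + ‖x‖ ^ 2) ^ ((q - r) / 2) ≤ C) : BddOp r q (fourierOp m) C := by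
  obtain ⟨L, hL, h, -⟩ := exists_fourierL2 (m := besselSymbol n q * (m * besselSymbol n (-r)))
    (by have := besselSymbol_hasTemperateGrowth n; 
        exact (this q).mul (hm.mul (this (-r)))) (C := C) (by
      intro x
      refine le_trans (le_of_eq ?_) (hC x)
      simp only [Pi.mul_apply, norm_mul, norm_besselSymbol]
      rw [sub_div, sub_eq_add_neg, Real.rpow_add (by positivity), neg_div]
      ring)
  refine ⟨L, hL, fun f => ?_⟩
  rw [← h, ← fourierOp_mul (by fun_prop) (hm.mul (by fun_prop)),
    ← fourierOp_mul hm (by fun_prop)]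
  rfl

theorem bddOp_one {n : ℕ} {r q : ℝ} (h : q ≤ r) : BddOp r q (1 : DistOp n) 1 := by
  have : (1 : DistOp n) = fourierOp (fun _ => 1) := by ext1 u; simp
  rw [this]
  refine bddOp_fourierOp (by fun_prop) fun x => ?_
  rw [norm_one, one_mul]
  exact Real.rpow_le_one_of_one_le_of_nonpos (by nlinarith [sq_nonneg ‖x‖]) (by linarith)

theorem bddOp_bessel {n : ℕ} {r q s : ℝ} (h : q + s ≤ r) : BddOp r q (bessel n s) 1 := by
  rw [bessel_eq]
  refine bddOp_fourierOp (by fun_prop) fun x => ?_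
  rw [norm_besselSymbol, ← Real.rpow_add (by positivity)]
  exact Real.rpow_le_one_of_one_le_of_nonpos (by nlinarith [sq_nonneg ‖x‖]) (by linarith)

end DeSitterKG
end

/-! ### Operators of integer order: derivatives, Bessel potentials, smooth coefficients. -/

noncomputable section

namespace DeSitterKG

open MeasureTheory Filter Topology TemperedDistribution FourierTransform
open scoped SchwartzMap ENNReal LineDeriv

/-! ### Coefficients of class `𝓑^∞` -/

theorem IsBInfty.clm_comp {n : ℕ} {F G : Type*} [NormedAddCommGroup F] [NormedSpace ℝ F]
    [NormedAddCommGroup G] [NormedSpace ℝ G] (L : F →L[ℝ] G) {f : Space n → F}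
    (hf : IsBInfty f) : IsBInfty (fun x => L (f x)) := by
  refine ⟨L.contDiff.comp hf.1, fun k => ?_⟩
  obtain ⟨C, hC⟩ := hf.2 k
  refine ⟨‖L‖ * C, fun x => ?_⟩
  refine (L.norm_iteratedFDeriv_comp_left hf.1.contDiffAt (by exact_mod_cast le_top)).trans ?_
  gcongr
  exact hC x

theorem IsBInfty.ofReal {n : ℕ} {f : Space n → ℝ} (hf : IsBInfty f) :
    IsBInfty (fun x => (f x : ℂ)) :=
  hf.clm_comp Complex.ofRealCLM

theorem IsBInfty.add {n : ℕ} {F : Type*} [NormedAddCommGroup F] [NormedSpace ℝ F]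
    {f g : Space n → F} (hf : IsBInfty f) (hg : IsBInfty g) : IsBInfty (fun x => f x + g x) := by
  refine ⟨hf.1.add hg.1, fun k => ?_⟩
  obtain ⟨C, hC⟩ := hf.2 k
  obtain ⟨D, hD⟩ := hg.2 k
  refine ⟨C + D, fun x => ?_⟩
  have h : iteratedFDeriv ℝ k (fun x => f x + g x) x =
      iteratedFDeriv ℝ k f x + iteratedFDeriv ℝ k g x :=
    iteratedFDeriv_add_apply (hf.1.of_le (by exact_mod_cast le_top)).contDiffAt
      (hg.1.of_le (by exact_mod_cast le_top)).contDiffAt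
  rw [h]
  exact (norm_add_le _ _).trans (add_le_add (hC x) (hD x))

/-- The partial derivative of a function. -/
def coordDeriv {n : ℕ} (i : Fin n) (a : Space n → ℂ) (x : Space n) : ℂ :=
  fderiv ℝ a x (EuclideanSpace.single i (1 : ℝ))

theorem IsBInfty.coordDeriv {n : ℕ} {a : Space n → ℂ} (ha : IsBInfty a) (i : Fin n) :
    IsBInfty (coordDeriv i a) := by
  have h : IsBInfty (fderiv ℝ a) := by
    refine ⟨ha.1.fderiv_right (by exact_mod_cast le_top), fun k => ?_⟩
    obtain ⟨C, hC⟩ := ha.2 (k + 1)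
    exact ⟨C, fun x => by rw [norm_iteratedFDeriv_fderiv]; exact hC x⟩
  exact h.clm_comp (ContinuousLinearMap.apply ℝ ℂ (EuclideanSpace.single i (1 : ℝ) : Space n))

theorem IsBInfty.exists_bound {n : ℕ} {F : Type*} [NormedAddCommGroup F] [NormedSpace ℝ F]
    {a : Space n → F} (ha : IsBInfty a) : ∃ C, ∀ x, ‖a x‖ ≤ C := by
  obtain ⟨C, hC⟩ := ha.2 0
  exact ⟨C, fun x => by simpa using hC x⟩

/-! ### Partial derivatives -/

/-- The partial derivative as an operator on tempered distributions. -/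
def dOp {n : ℕ} (i : Fin n) : DistOp n :=
  LineDeriv.lineDerivOpCLM ℂ (Dist n) (EuclideanSpace.single i (1 : ℝ) : Space n)

theorem dOp_mul_mulOp {n : ℕ} (i : Fin n) {a : Space n → ℂ} (ha : IsBInfty a) :
    dOp i * mulOp a = mulOp (coordDeriv i a) + mulOp a * dOp i := by
  have h := ha.hasTemperateGrowth
  have h' := (ha.coordDeriv i).hasTemperateGrowth
  ext u φ
  change u (SchwartzMap.smulLeftCLM ℂ a (-∂_{(EuclideanSpace.single i (1 : ℝ) : Space n)} φ)) =
    u (SchwartzMap.smulLeftCLM ℂ (coordDeriv i a) φ) +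
      u (-∂_{(EuclideanSpace.single i (1 : ℝ) : Space n)} (SchwartzMap.smulLeftCLM ℂ a φ))
  rw [← map_add]
  congr 1
  ext x
  have hd : fderiv ℝ (SchwartzMap.smulLeftCLM ℂ a φ) x =
      a x • fderiv ℝ φ x + φ x • fderiv ℝ a x := by
    rw [SchwartzMap.smulLeftCLM_apply h]
    exact fderiv_mul ((ha.1.differentiable (by simp)) x) φ.differentiableAt
  simp only [SchwartzMap.smulLeftCLM_apply_apply h, _root_.add_apply, _root_.neg_apply,
    SchwartzMap.smulLeftCLM_apply_apply h', SchwartzMap.lineDerivOp_apply_eq_fderiv, hd,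
    coordDeriv, _root_.smul_apply, smul_eq_mul]
  ring

theorem dOp_eq {n : ℕ} (i : Fin n) :
    dOp i = fourierOp (fun x : Space n => 2 * Real.pi * Complex.I * (x i : ℂ)) := by
  have h : (fun x : Space n => 2 * Real.pi * Complex.I * (x i : ℂ)) =
      (2 * Real.pi * Complex.I) •
        (fun x : Space n => (inner ℝ x (EuclideanSpace.single i (1 : ℝ)) : ℂ)) := by
    ext x
    simp [EuclideanSpace.inner_single_right]
  rw [h, fourierOp, fourierMultiplierCLM_smul (by fun_prop)]
  ext1 u
  exact lineDeriv_eq_fourierMultiplierCLM _ u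

@[fun_prop]
theorem dSymbol_hasTemperateGrowth {n : ℕ} (i : Fin n) :
    (fun x : Space n => 2 * Real.pi * Complex.I * (x i : ℂ)).HasTemperateGrowth := by
  have h : (fun x : Space n => x i).HasTemperateGrowth :=
    (EuclideanSpace.proj (𝕜 := ℝ) i : Space n →L[ℝ] ℝ).hasTemperateGrowth
  fun_prop

theorem dOp_comm {n : ℕ} (i j : Fin n) : dOp i * dOp j = dOp j * dOp i := by
  rw [dOp_eq, dOp_eq, fourierOp_mul (by fun_prop) (by fun_prop),
    fourierOp_mul (by fun_prop) (by fun_prop), mul_comm]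

theorem abs_coord_le {n : ℕ} (x : Space n) (i : Fin n) : |x i| ≤ (1 + ‖x‖ ^ 2) ^ (1 / 2 : ℝ) := by
  rw [← Real.sqrt_eq_rpow]
  have h := PiLp.norm_apply_le x i
  rw [Real.norm_eq_abs] at h
  exact Real.le_sqrt_of_sq_le (by nlinarith [abs_nonneg (x i)])

theorem bddOp_dOp {n : ℕ} (i : Fin n) (r : ℝ) : BddOp r (r - 1) (dOp i) (2 * Real.pi) := by
  rw [dOp_eq]
  refine bddOp_fourierOp (by fun_prop) fun x => ?_
  have h1 : ‖(2 * Real.pi * Complex.I * (x i : ℂ))‖ = 2 * Real.pi * |x i| := by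
    simp [abs_of_pos Real.pi_pos]
  have h2 : (1 + ‖x‖ ^ 2) ^ (1 / 2 : ℝ) * (1 + ‖x‖ ^ 2) ^ ((r - 1 - r) / 2) = 1 := by
    rw [← Real.rpow_add (by positivity), show (1 / 2 : ℝ) + (r - 1 - r) / 2 = 0 by ring,
      Real.rpow_zero]
  calc _ ≤ 2 * Real.pi * (1 + ‖x‖ ^ 2) ^ (1 / 2 : ℝ) * (1 + ‖x‖ ^ 2) ^ ((r - 1 - r) / 2) := by
        rw [h1]; gcongr; exact abs_coord_le x i
    _ = 2 * Real.pi := by rw [mul_assoc, h2, mul_one]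

/-- The constant (2π)⁻² comes from the symbol 2πiξ_i of ∂_i. This identity lets statements about Λ²
be reduced to statements about single derivatives. -/
theorem bessel_two (n : ℕ) :
    bessel n 2 = 1 - (((2 * Real.pi) ^ 2)⁻¹ : ℂ) • ∑ i : Fin n, dOp i * dOp i := by
  have hpi : (Real.pi : ℂ) ≠ 0 := by exact_mod_cast Real.pi_ne_zero
  have h1 : ∑ i : Fin n, dOp i * dOp i = fourierOp (fun x : Space n =>
      ∑ i, (2 * Real.pi * Complex.I * (x i : ℂ)) * (2 * Real.pi * Complex.I * (x i : ℂ))) := by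
    rw [fourierOp, fourierMultiplierCLM_sum ℂ (fun i _ => by fun_prop)]
    refine Finset.sum_congr rfl fun i _ => ?_
    rw [dOp_eq, fourierOp_mul (by fun_prop) (by fun_prop)]
    rfl
  have h2 : (1 : DistOp n) = fourierOp (fun _ => 1) := by ext1 u; simp
  have h3 : (fun x : Space n =>
      ∑ i, (2 * Real.pi * Complex.I * (x i : ℂ)) * (2 * Real.pi * Complex.I * (x i : ℂ))) =
      (-(2 * Real.pi) ^ 2 : ℂ) • fun x : Space n => ((‖x‖ ^ 2 : ℝ) : ℂ) := by
    ext x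
    simp only [EuclideanSpace.norm_sq_eq, Pi.smul_apply, smul_eq_mul, Complex.ofReal_sum,
      Finset.mul_sum, Real.norm_eq_abs, sq_abs, Complex.ofReal_pow]
    refine Finset.sum_congr rfl fun i _ => ?_
    linear_combination (4 * (Real.pi : ℂ) ^ 2 * (x i : ℂ) ^ 2) * Complex.I_mul_I
  have h4 : besselSymbol n 2 = (fun _ => 1) + fun x : Space n => ((‖x‖ ^ 2 : ℝ) : ℂ) := by
    ext x
    simp [besselSymbol]
  rw [bessel_eq, h1, h2, h3, h4, fourierOp, fourierOp, fourierOp,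
    fourierMultiplierCLM_smul (by fun_prop), smul_smul]
  have h5 : (((2 * Real.pi) ^ 2)⁻¹ : ℂ) * -(2 * Real.pi) ^ 2 = -1 := by field_simp
  rw [h5]
  ext1 u
  simp only [fourierMultiplierCLM_apply, _root_.sub_apply, _root_.smul_apply,
    smulLeftCLM_add (F := ℂ) (Function.HasTemperateGrowth.const (E := Space n) (1 : ℂ))
    (by fun_prop : (fun x : Space n => ((‖x‖ ^ 2 : ℝ) : ℂ)).HasTemperateGrowth),
    _root_.add_apply, FourierTransform.fourierInv_add]
  simp

/-! ### The filtered algebra of operators of finite order -/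

theorem bessel_neg_two_mul_bessel_two (n : ℕ) : bessel n (-2) * bessel n 2 = 1 := by
  rw [bessel_mul_bessel, neg_add_cancel, bessel_zero]

theorem bessel_two_mul_bessel_neg_two (n : ℕ) : bessel n 2 * bessel n (-2) = 1 := by
  rw [bessel_mul_bessel, add_neg_cancel, bessel_zero]

/-- Insert 1 = Λ⁻²Λ² on the left of T and expand Λ²: the factors Λ⁻² and Λ⁻²∂_i regain two and one
orders, and only T and ∂_i T remain to be bounded. -/
theorem BddOp.gain {n : ℕ} {r q : ℝ} {T : DistOp n} {C D : ℝ} (h : BddOp r q T C)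
    (hd : ∀ i, BddOp r q (dOp i * T) D) : ∃ C', BddOp r (q + 1) T C' := by
  have key : T = bessel n (-2) * T -
      (((2 * Real.pi) ^ 2)⁻¹ : ℂ) • ∑ i : Fin n, (bessel n (-2) * dOp i) * (dOp i * T) := by
    calc T = bessel n (-2) * bessel n 2 * T := by rw [bessel_neg_two_mul_bessel_two, one_mul]
      _ = _ := by
        rw [bessel_two, mul_sub, mul_one, sub_mul, mul_smul_comm, smul_mul_assoc, Finset.mul_sum,
          Finset.sum_mul]
        simp only [mul_assoc]
  rw [key]
  exact ⟨_, ((bddOp_bessel (by linarith)).mul h).sub ((BddOp.sum _ fun i =>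
    ((bddOp_bessel (q := q + 1) (by linarith)).mul (bddOp_dOp i q)).mul (hd i)).smul _)⟩

/-- The mirror image of `BddOp.gain`, with Λ²Λ⁻² inserted on the right. It gives access to negative
indices without duality. -/
theorem BddOp.lose {n : ℕ} {r q : ℝ} {T : DistOp n} {C D : ℝ} (h : BddOp r q T C)
    (hd : ∀ i, BddOp r q (T * dOp i) D) : ∃ C', BddOp (r - 1) q T C' := by
  have key : T = T * bessel n (-2) -
      (((2 * Real.pi) ^ 2)⁻¹ : ℂ) • ∑ i : Fin n, (T * dOp i) * (dOp i * bessel n (-2)) := by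
    calc T = T * (bessel n 2 * bessel n (-2)) := by rw [bessel_two_mul_bessel_neg_two, mul_one]
      _ = _ := by
        rw [bessel_two, sub_mul, one_mul, mul_sub, smul_mul_assoc, mul_smul_comm, Finset.sum_mul,
          Finset.mul_sum]
        simp only [mul_assoc]
  rw [key]
  exact ⟨_, (h.mul (bddOp_bessel (by linarith))).sub ((BddOp.sum _ fun i =>
    (hd i).mul (((bddOp_dOp i (r + 1)).mul (bddOp_bessel (r := r - 1) (by linarith))) |>
      fun h => by simpa using h)).smul _)⟩

/-- Induction on k by the Leibniz rule: ∂_i a = (∂_i a) + a∂_i is bounded from H_(k+1) to H_(k), and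
`BddOp.gain` then raises the target by one. The induction runs over all a at once because ∂_i a is
again a multiplier. -/
theorem exists_bddOp_mulOp_nat {n : ℕ} (k : ℕ) :
    ∀ {a : Space n → ℂ}, IsBInfty a → ∃ C, BddOp (k : ℝ) k (mulOp a) C := by
  induction k with
  | zero =>
    intro a ha
    obtain ⟨C, hC⟩ := ha.exists_bound
    exact ⟨C, by simpa using bddOp_mulOp_zero ha.hasTemperateGrowth hC⟩
  | succ k ih =>
    intro a ha
    obtain ⟨C, hC⟩ := ih ha
    choose D hD using fun i => ih (ha.coordDeriv i)
    have h1 : BddOp ((k + 1 : ℕ) : ℝ) (k : ℝ) (1 : DistOp n) 1 := bddOp_one (by simp)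
    have h2 : ∀ i, BddOp ((k + 1 : ℕ) : ℝ) (k : ℝ) (dOp i * mulOp a)
        -- `BddOp.gain` wants one constant for all i; summing the nonnegative bounds over j supplies
        -- it.
        (∑ j, (D j * 1 + C * (2 * Real.pi))) := by
      intro i
      rw [dOp_mul_mulOp i ha]
      have h3 := bddOp_dOp i ((k + 1 : ℕ) : ℝ)
      rw [show ((k + 1 : ℕ) : ℝ) - 1 = k by push_cast; ring] at h3
      have h4 := ((hD i).mul h1).add (hC.mul h3)
      rw [mul_one] at h4
      refine h4.mono ?_
      refine Finset.single_le_sum (f := fun j => D j * 1 + C * (2 * Real.pi)) (fun j _ => ?_)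
        (Finset.mem_univ i)
      have := (hD j).nonneg
      have := hC.nonneg
      positivity
    have := (hC.mul h1).gain (D := ∑ j, (D j * 1 + C * (2 * Real.pi))) (by simpa using h2)
    simpa using this

theorem exists_bddOp_mulOp_neg_nat {n : ℕ} (k : ℕ) :
    ∀ {a : Space n → ℂ}, IsBInfty a → ∃ C, BddOp (-k : ℝ) (-k) (mulOp a) C := by
  induction k with
  | zero =>
    intro a ha
    simpa using exists_bddOp_mulOp_nat 0 ha
  | succ k ih =>
    intro a ha
    obtain ⟨C, hC⟩ := ih ha
    choose D hD using fun i => ih (ha.coordDeriv i)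
    have h1 : BddOp (-k : ℝ) (-(k + 1 : ℕ) : ℝ) (1 : DistOp n) 1 := bddOp_one (by simp)
    have h2 : ∀ i, BddOp (-k : ℝ) (-(k + 1 : ℕ) : ℝ) (mulOp a * dOp i)
        (∑ j, (2 * Real.pi * C + 1 * D j)) := by
      intro i
      have h0 : mulOp a * dOp i = dOp i * mulOp a - mulOp (coordDeriv i a) := by
        rw [dOp_mul_mulOp i ha]; abel
      rw [h0]
      have h3 := bddOp_dOp i (-k : ℝ)
      rw [show (-k : ℝ) - 1 = (-(k + 1 : ℕ) : ℝ) by push_cast; ring] at h3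
      have h4 := (h3.mul hC).sub (h1.mul (hD i))
      rw [one_mul] at h4
      refine h4.mono ?_
      refine Finset.single_le_sum (f := fun j => 2 * Real.pi * C + 1 * D j) (fun j _ => ?_)
        (Finset.mem_univ i)
      have := (hD j).nonneg
      have := hC.nonneg
      have := Real.pi_pos
      positivity
    obtain ⟨C', h⟩ := (h1.mul hC).lose (D := ∑ j, (2 * Real.pi * C + 1 * D j)) (by simpa using h2)
    refine ⟨C', ?_⟩
    rw [one_mul] at h
    convert h using 1
    push_cast
    ring

/-- Operators of order `m`: they map `H_(k)` to `H_(k-m)` for every integer `k`. -/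
def HasOrder {n : ℕ} (m : ℤ) (T : DistOp n) : Prop :=
  ∀ k : ℤ, ∃ C, BddOp (k : ℝ) (k - m) T C

theorem HasOrder.mul {n : ℕ} {m p q : ℤ} {S T : DistOp n} (hS : HasOrder m S) (hT : HasOrder p T)
    (h : m + p = q) : HasOrder q (S * T) := by
  intro k
  obtain ⟨C, hC⟩ := hT k
  obtain ⟨D, hD⟩ := hS (k - p)
  refine ⟨D * C, ?_⟩
  subst h
  push_cast at hD ⊢
  rw [← sub_sub, sub_right_comm]
  exact hD.mul hC

theorem HasOrder.add {n : ℕ} {m : ℤ} {S T : DistOp n} (hS : HasOrder m S) (hT : HasOrder m T) :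
    HasOrder m (S + T) := by
  intro k
  obtain ⟨C, hC⟩ := hS k
  obtain ⟨D, hD⟩ := hT k
  exact ⟨_, hC.add hD⟩

theorem HasOrder.sub {n : ℕ} {m : ℤ} {S T : DistOp n} (hS : HasOrder m S) (hT : HasOrder m T) :
    HasOrder m (S - T) := by
  intro k
  obtain ⟨C, hC⟩ := hS k
  obtain ⟨D, hD⟩ := hT k
  exact ⟨_, hC.sub hD⟩

theorem HasOrder.smul {n : ℕ} {m : ℤ} {T : DistOp n} (hT : HasOrder m T) (c : ℂ) :
    HasOrder m (c • T) := by
  intro k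
  obtain ⟨C, hC⟩ := hT k
  exact ⟨_, hC.smul c⟩

theorem HasOrder.sum {n : ℕ} {m : ℤ} {ι : Type*} (s : Finset ι) {T : ι → DistOp n}
    (hT : ∀ i, HasOrder m (T i)) : HasOrder m (∑ i ∈ s, T i) := by
  intro k
  choose C hC using fun i => hT i k
  exact ⟨_, BddOp.sum s hC⟩

theorem hasOrder_bessel (n : ℕ) (m : ℤ) : HasOrder m (bessel n m) :=
  fun k => ⟨1, bddOp_bessel (by linarith)⟩

theorem HasOrder.mono {n : ℕ} {m p : ℤ} {T : DistOp n} (hT : HasOrder m T) (h : m ≤ p) :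
    HasOrder p T := by
  intro k
  obtain ⟨C, hC⟩ := hT k
  have h' : (m : ℝ) ≤ p := by exact_mod_cast h
  have := (bddOp_one (n := n) (q := k - p) (r := k - m) (by linarith)).mul hC
  rw [one_mul] at this
  exact ⟨_, this⟩

theorem hasOrder_dOp {n : ℕ} (i : Fin n) : HasOrder 1 (dOp i) :=
  fun k => ⟨_, by simpa using bddOp_dOp i k⟩

theorem IsBInfty.hasOrder_mulOp {n : ℕ} {a : Space n → ℂ} (ha : IsBInfty a) :
    HasOrder 0 (mulOp a) := by
  intro k
  obtain ⟨l, rfl | rfl⟩ := k.eq_nat_or_neg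
  · simpa using exists_bddOp_mulOp_nat l ha
  · simpa using exists_bddOp_mulOp_neg_nat l ha

end DeSitterKG
end

/-! ### Commutators, the operator A, and its uniform intertwining with frequency localizations. -/

noncomputable section

namespace DeSitterKG

open MeasureTheory Filter Topology TemperedDistribution FourierTransform
open scoped SchwartzMap ENNReal LineDeriv

/-- Operators of order `m` whose commutators with the partial derivatives are also of
order `m`. -/
def IsDiffLike {n : ℕ} (m : ℤ) (T : DistOp n) : Prop :=
  HasOrder m T ∧ ∀ i, HasOrder m (dOp i * T - T * dOp i)

theorem IsDiffLike.mul {n : ℕ} {m p q : ℤ} {S T : DistOp n} (hS : IsDiffLike m S)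
    (hT : IsDiffLike p T) (h : m + p = q) : IsDiffLike q (S * T) := by
  refine ⟨hS.1.mul hT.1 h, fun i => ?_⟩
  rw [show dOp i * (S * T) - S * T * dOp i =
    (dOp i * S - S * dOp i) * T + S * (dOp i * T - T * dOp i) by noncomm_ring]
  exact ((hS.2 i).mul hT.1 h).add (hS.1.mul (hT.2 i) h)

theorem IsDiffLike.add {n : ℕ} {m : ℤ} {S T : DistOp n} (hS : IsDiffLike m S)
    (hT : IsDiffLike m T) : IsDiffLike m (S + T) := by
  refine ⟨hS.1.add hT.1, fun i => ?_⟩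
  rw [show dOp i * (S + T) - (S + T) * dOp i =
    (dOp i * S - S * dOp i) + (dOp i * T - T * dOp i) by noncomm_ring]
  exact (hS.2 i).add (hT.2 i)

theorem IsDiffLike.mono {n : ℕ} {m p : ℤ} {T : DistOp n} (hT : IsDiffLike m T) (h : m ≤ p) :
    IsDiffLike p T :=
  ⟨hT.1.mono h, fun i => (hT.2 i).mono h⟩

theorem IsDiffLike.sum {n : ℕ} {m : ℤ} {ι : Type*} (s : Finset ι) {T : ι → DistOp n}
    (hT : ∀ i, IsDiffLike m (T i)) : IsDiffLike m (∑ i ∈ s, T i) := by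
  refine ⟨HasOrder.sum s fun i => (hT i).1, fun j => ?_⟩
  rw [Finset.mul_sum, Finset.sum_mul, ← Finset.sum_sub_distrib]
  exact HasOrder.sum s fun i => (hT i).2 j

theorem IsBInfty.isDiffLike_mulOp {n : ℕ} {a : Space n → ℂ} (ha : IsBInfty a) :
    IsDiffLike 0 (mulOp a) := by
  refine ⟨ha.hasOrder_mulOp, fun i => ?_⟩
  rw [dOp_mul_mulOp i ha, add_sub_cancel_right]
  exact (ha.coordDeriv i).hasOrder_mulOp

theorem isDiffLike_dOp {n : ℕ} (i : Fin n) : IsDiffLike 1 (dOp i) := by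
  refine ⟨hasOrder_dOp i, fun j => ?_⟩
  rw [dOp_comm, sub_self]
  simpa using (hasOrder_dOp i).smul 0

/-- One order better than the naive m + 2, because [∂²,T] = ∂[∂,T] + [∂,T]∂ and [∂,T] still has
order m. -/
theorem IsDiffLike.commutator_bessel_two {n : ℕ} {m p : ℤ} {T : DistOp n} (hT : IsDiffLike m T)
    (h : m + 1 = p) : HasOrder p (bessel n 2 * T - T * bessel n 2) := by
  rw [bessel_two]
  have : (1 - (((2 * Real.pi) ^ 2)⁻¹ : ℂ) • ∑ i : Fin n, dOp i * dOp i) * T -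
      T * (1 - (((2 * Real.pi) ^ 2)⁻¹ : ℂ) • ∑ i : Fin n, dOp i * dOp i) =
      (-(((2 * Real.pi) ^ 2)⁻¹ : ℂ)) • ∑ i : Fin n, (dOp i * (dOp i * T - T * dOp i) +
        (dOp i * T - T * dOp i) * dOp i) := by
    rw [sub_mul, mul_sub, one_mul, mul_one, smul_mul_assoc, mul_smul_comm, Finset.sum_mul,
      Finset.mul_sum, sub_sub_sub_cancel_left, neg_smul, ← smul_sub, ← smul_neg,
      ← Finset.sum_sub_distrib, ← Finset.sum_neg_distrib]
    congr 1
    refine Finset.sum_congr rfl fun i _ => ?_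
    noncomm_ring
  rw [this]
  exact (HasOrder.sum _ fun i => ((hasOrder_dOp i).mul (hT.2 i) (by omega)).add
    ((hT.2 i).mul (hasOrder_dOp i) (by omega))).smul _

theorem HasOrder.bessel_conj {n : ℕ} {m : ℤ} {T : DistOp n} (hT : HasOrder m T) (k : ℤ) :
    HasOrder m (bessel n k * T * bessel n (-k)) := by
  have := ((hasOrder_bessel n k).mul hT rfl).mul (hasOrder_bessel n (-k)) (q := m) (by ring)
  simpa using this

/-- Conjugation by an even power of Λ changes T only at lower order. In the upward step, Λ²XΛ⁻² − T
= Λ²(X − T)Λ⁻² + [Λ²,T]Λ⁻², where the last term has order (p+1) − 2; the downward step is analogous.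
-/
theorem IsDiffLike.bessel_conj_sub {n : ℕ} {m p : ℤ} {T : DistOp n} (hT : IsDiffLike p T)
    (h : m + 1 = p) (k : ℤ) : HasOrder m (bessel n (2 * k : ℤ) * T * bessel n (-(2 * k : ℤ)) - T) := by
  have hc := hT.commutator_bessel_two rfl
  have e1 : bessel n 2 * bessel n (-2) = 1 := bessel_two_mul_bessel_neg_two n
  have e2 : bessel n (-2) * bessel n 2 = 1 := bessel_neg_two_mul_bessel_two n
  induction k with
  | zero =>
    have : HasOrder m (0 : DistOp n) := by
      simpa using (hT.1.mul (hasOrder_bessel n (-1)) (q := m) (by omega)).smul 0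
    have e : ((2 * (0 : ℤ) : ℤ) : ℝ) = 0 := by norm_num
    rwa [e, neg_zero, bessel_zero, one_mul, mul_one, sub_self]
  | succ k ih =>
    have h1 := ih.bessel_conj 2
    have h2 : HasOrder m ((bessel n 2 * T - T * bessel n 2) * bessel n (-2)) := by
      simpa using hc.mul (hasOrder_bessel n (-2)) (q := m) (by omega)
    have h3 := h1.add h2
    have e3 : bessel n (2 * (k + 1 : ℤ) : ℤ) = bessel n 2 * bessel n (2 * (k : ℤ) : ℤ) := by
      rw [bessel_mul_bessel]; congr 1; push_cast; ring
    have e4 : bessel n (-(2 * (k + 1 : ℤ) : ℤ)) =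
        bessel n (-(2 * (k : ℤ) : ℤ)) * bessel n (-2) := by
      rw [bessel_mul_bessel]; congr 1; push_cast; ring
    rw [e3, e4]
    convert h3 using 1
    push_cast
    rw [mul_sub, sub_mul, sub_mul, mul_assoc T, e1]
    noncomm_ring
  | pred k ih =>
    have h1 := ih.bessel_conj (-2)
    have h2 : HasOrder m (bessel n (-2) * (bessel n 2 * T - T * bessel n 2)) := by
      simpa using (hasOrder_bessel n (-2)).mul hc (q := m) (by omega)
    have h3 := h1.sub h2
    have e3 : bessel n (2 * (-k - 1 : ℤ) : ℤ) = bessel n (-2) * bessel n (2 * (-k : ℤ) : ℤ) := by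
      rw [bessel_mul_bessel]; congr 1; push_cast; ring
    have e4 : bessel n (-(2 * (-k - 1 : ℤ) : ℤ)) =
        bessel n (-(2 * (-k : ℤ) : ℤ)) * bessel n 2 := by
      rw [bessel_mul_bessel]; congr 1; push_cast; ring
    rw [e3, e4]
    convert h3 using 1
    push_cast
    rw [neg_neg (2 : ℝ), mul_sub, sub_mul, mul_sub (bessel n (-2)) (bessel n 2 * T),
      ← mul_assoc (bessel n (-2)) (bessel n 2) T, e2]
    noncomm_ring

/-! ### The operator `A` -/

/-- `A` as a continuous linear operator on tempered distributions. -/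
def SecondOrderOp.op {n : ℕ} (A : SecondOrderOp n) : DistOp n :=
  (∑ i, ∑ j, mulOp (fun x => (A.a i j x : ℂ)) * (dOp i * dOp j)) +
    (∑ j, mulOp (A.b j) * dOp j) + mulOp A.c

theorem SecondOrderOp.op_apply {n : ℕ} (A : SecondOrderOp n) (u : Dist n) :
    A.op u = A.apply u := by
  simp only [SecondOrderOp.op, SecondOrderOp.apply, _root_.add_apply, _root_.sum_apply]
  rfl

theorem SecondOrderOp.HasBInftyCoeffs.isDiffLike_op {n : ℕ} {A : SecondOrderOp n}
    (hA : A.HasBInftyCoeffs) : IsDiffLike 2 A.op := by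
  refine IsDiffLike.add (IsDiffLike.add ?_ ?_) (hA.c.isDiffLike_mulOp.mono (by norm_num))
  · exact IsDiffLike.sum _ fun i => IsDiffLike.sum _ fun j =>
      (hA.a i j).ofReal.isDiffLike_mulOp.mul ((isDiffLike_dOp i).mul (isDiffLike_dOp j) rfl) rfl
  · exact IsDiffLike.sum _ fun j => ((hA.b j).isDiffLike_mulOp.mul (isDiffLike_dOp j) rfl).mono
      (by norm_num)

/-- The symmetrized coefficients of second order. -/
def SecondOrderOp.symm {n : ℕ} (A : SecondOrderOp n) (i j : Fin n) (x : Space n) : ℝ :=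
  (1 / 2 : ℝ) * (A.a i j x + A.a j i x)

theorem SecondOrderOp.symm_comm {n : ℕ} (A : SecondOrderOp n) (i j : Fin n) :
    A.symm i j = A.symm j i := by
  ext x
  simp only [SecondOrderOp.symm, add_comm]

theorem SecondOrderOp.HasBInftyCoeffs.symm {n : ℕ} {A : SecondOrderOp n}
    (hA : A.HasBInftyCoeffs) (i j : Fin n) : IsBInfty (A.symm i j) :=
  ((hA.a i j).add (hA.a j i)).clm_comp (ContinuousLinearMap.mul ℝ ℝ (1 / 2))

theorem SecondOrderOp.sum_symm {n : ℕ} (A : SecondOrderOp n) (x : Space n) (ξ : Fin n → ℝ) :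
    ∑ i, ∑ j, A.symm i j x * ξ i * ξ j = ∑ i, ∑ j, A.a i j x * ξ i * ξ j := by
  have h : ∑ i, ∑ j, A.a j i x * ξ i * ξ j = ∑ i, ∑ j, A.a i j x * ξ i * ξ j := by
    rw [Finset.sum_comm]
    exact Finset.sum_congr rfl fun i _ => Finset.sum_congr rfl fun j _ => by ring
  calc _ = (1 / 2 : ℝ) * (∑ i, ∑ j, A.a i j x * ξ i * ξ j) +
        (1 / 2 : ℝ) * ∑ i, ∑ j, A.a j i x * ξ i * ξ j := by
        simp only [Finset.mul_sum, ← Finset.sum_add_distrib, SecondOrderOp.symm]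
        exact Finset.sum_congr rfl fun i _ => Finset.sum_congr rfl fun j _ => by ring
    _ = _ := by rw [h]; ring

/-- The principal part of `A` in divergence form. -/
def SecondOrderOp.divOp {n : ℕ} (A : SecondOrderOp n) : DistOp n :=
  ∑ i, ∑ j, dOp i * (mulOp (fun x => (A.symm i j x : ℂ)) * dOp j)

/-- Since derivatives commute, symmetrizing the a_ij does not change the principal part; passing to
divergence form costs only the first order terms (∂_i a_ij)∂_j. -/
theorem SecondOrderOp.HasBInftyCoeffs.hasOrder_op_sub_divOp {n : ℕ} {A : SecondOrderOp n}
    (hA : A.HasBInftyCoeffs) : HasOrder 1 (A.op - A.divOp) := by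
  have hs : ∀ i j, mulOp (fun x => (A.symm i j x : ℂ)) =
      (1 / 2 : ℂ) • (mulOp (fun x => (A.a i j x : ℂ)) + mulOp (fun x => (A.a j i x : ℂ))) := by
    intro i j
    have h1 := (hA.a i j).ofReal.hasTemperateGrowth
    have h2 := (hA.a j i).ofReal.hasTemperateGrowth
    rw [mulOp, mulOp, mulOp, ← smulLeftCLM_add h1 h2, ← smulLeftCLM_smul (h1.add h2)]
    congr 1
    ext x
    simp [SecondOrderOp.symm]
  have h1 : ∑ i, ∑ j, mulOp (fun x => (A.a i j x : ℂ)) * (dOp i * dOp j) =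
      ∑ i, ∑ j, mulOp (fun x => (A.symm i j x : ℂ)) * (dOp i * dOp j) := by
    have h : ∑ i, ∑ j, mulOp (fun x => (A.a j i x : ℂ)) * (dOp i * dOp j) =
        ∑ i, ∑ j, mulOp (fun x => (A.a i j x : ℂ)) * (dOp i * dOp j) := by
      rw [Finset.sum_comm]
      exact Finset.sum_congr rfl fun i _ => Finset.sum_congr rfl fun j _ => by rw [dOp_comm]
    simp only [hs, smul_mul_assoc, add_mul, ← Finset.smul_sum, Finset.sum_add_distrib, h]
    rw [← two_smul ℂ (∑ i, ∑ j, mulOp (fun x => (A.a i j x : ℂ)) * (dOp i * dOp j)), smul_smul]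
    norm_num
  have h2 : A.divOp = (∑ i, ∑ j, mulOp (fun x => (A.symm i j x : ℂ)) * (dOp i * dOp j)) +
      ∑ i, ∑ j, mulOp (coordDeriv i fun x => (A.symm i j x : ℂ)) * dOp j := by
    simp only [SecondOrderOp.divOp, ← Finset.sum_add_distrib]
    refine Finset.sum_congr rfl fun i _ => Finset.sum_congr rfl fun j _ => ?_
    rw [← mul_assoc, dOp_mul_mulOp i (hA.symm i j).ofReal]
    noncomm_ring
  have h3 : A.op - A.divOp = (∑ j, mulOp (A.b j) * dOp j) + mulOp A.c -
      ∑ i, ∑ j, mulOp (coordDeriv i fun x => (A.symm i j x : ℂ)) * dOp j := by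
    rw [h2, SecondOrderOp.op, h1]
    abel
  rw [h3]
  refine HasOrder.sub (HasOrder.add ?_ (hA.c.hasOrder_mulOp.mono (by norm_num))) ?_
  · exact HasOrder.sum _ fun j => (hA.b j).hasOrder_mulOp.mul (hasOrder_dOp j) rfl
  · exact HasOrder.sum _ fun i => HasOrder.sum _ fun j =>
      ((hA.symm i j).ofReal.coordDeriv i).hasOrder_mulOp.mul (hasOrder_dOp j) rfl

/-! ### Resolvents -/

/-- The symbol of the resolvent. -/
def resolventSymbol (n : ℕ) (l : ℝ) (x : Space n) : ℂ := ((l + (1 + ‖x‖ ^ 2))⁻¹ : ℝ)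

/-- The resolvent of the Bessel potential of order two. -/
def resolventOp (n : ℕ) (l : ℝ) : DistOp n := fourierOp (resolventSymbol n l)

theorem resolventSymbol_hasTemperateGrowth (n : ℕ) {l : ℝ} (hl : 0 ≤ l) :
    (resolventSymbol n l).HasTemperateGrowth := by
  -- Rescaling x by (l+1)^{-1/2} turns the symbol into a multiple of (1+|y|²)⁻¹, whose temperate
  -- growth is known.
  have h : resolventSymbol n l = fun x : Space n => (((l + 1)⁻¹ : ℝ) : ℂ) *
      (((1 + ‖(Real.sqrt (l + 1))⁻¹ • x‖ ^ 2) ^ (-1 : ℝ) : ℝ) : ℂ) := by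
    ext x
    rw [resolventSymbol, ← Complex.ofReal_mul, norm_smul, Real.rpow_neg_one, ← mul_inv, mul_pow,
      Real.norm_eq_abs, sq_abs, inv_pow, Real.sq_sqrt (by linarith), mul_add, ← mul_assoc,
      mul_inv_cancel₀ (by linarith)]
    ring_nf
  have h1 := Function.hasTemperateGrowth_one_add_norm_sq_rpow (Space n) (-1)
  have h2 : (fun x : Space n => (Real.sqrt (l + 1))⁻¹ • x).HasTemperateGrowth := by fun_prop
  have h3 : (fun x : Space n =>
      (1 + ‖(Real.sqrt (l + 1))⁻¹ • x‖ ^ 2) ^ (-1 : ℝ)).HasTemperateGrowth := h1.comp h2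
  rw [h]
  fun_prop

theorem norm_resolventSymbol (n : ℕ) {l : ℝ} (hl : 0 ≤ l) (x : Space n) :
    ‖resolventSymbol n l x‖ = (l + (1 + ‖x‖ ^ 2))⁻¹ := by
  rw [resolventSymbol, Complex.norm_real, Real.norm_of_nonneg (by positivity)]

theorem resolvent_mul_eq_one (n : ℕ) {l : ℝ} (hl : 0 ≤ l) :
    resolventOp n l * ((l : ℂ) • 1 + bessel n 2) = 1 ∧
      ((l : ℂ) • 1 + bessel n 2) * resolventOp n l = 1 := by
  have h2 : (1 : DistOp n) = fourierOp (fun _ => 1) := by ext1 u; simp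
  have h3 : ((l : ℂ) • 1 + bessel n 2) = fourierOp ((fun _ => (l : ℂ)) + besselSymbol n 2) := by
    ext1 u
    simp only [bessel_eq, fourierMultiplierCLM_apply, _root_.add_apply, _root_.smul_apply,
      smulLeftCLM_add (F := ℂ) (Function.HasTemperateGrowth.const (E := Space n) (l : ℂ))
      (besselSymbol_hasTemperateGrowth n 2), FourierTransform.fourierInv_add]
    simp
    rfl
  have h4 : ((fun _ => (l : ℂ)) + besselSymbol n 2) * resolventSymbol n l = fun _ => 1 := by
    ext x
    have : ((l + (1 + ‖x‖ ^ 2) : ℝ) : ℂ) ≠ 0 := by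
      rw [Complex.ofReal_ne_zero]; positivity
    simp only [Pi.mul_apply, Pi.add_apply, besselSymbol, resolventSymbol]
    rw [div_self two_ne_zero, Real.rpow_one, ← Complex.ofReal_add, ← Complex.ofReal_mul,
      mul_inv_cancel₀ (by positivity), Complex.ofReal_one]
  have h5 := resolventSymbol_hasTemperateGrowth n hl
  rw [h3, resolventOp, fourierOp_mul h5 (by fun_prop), fourierOp_mul (by fun_prop) h5,
    mul_comm (resolventSymbol n l), h4, h2]
  exact ⟨rfl, rfl⟩

/-- The point is the constant 1: the resolvent gains two derivatives uniformly in l. The companion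
bound on l·R below compensates an explicit factor l at the price of that gain. -/
theorem bddOp_resolventOp (n : ℕ) {l : ℝ} (hl : 0 ≤ l) {r q : ℝ} (h : q ≤ r + 2) :
    BddOp r q (resolventOp n l) 1 := by
  refine bddOp_fourierOp (resolventSymbol_hasTemperateGrowth n hl) fun x => ?_
  rw [norm_resolventSymbol n hl]
  have h1 : (1 + ‖x‖ ^ 2) ^ ((q - r) / 2) ≤ (1 + ‖x‖ ^ 2) ^ (1 : ℝ) :=
    Real.rpow_le_rpow_of_exponent_le (by nlinarith [sq_nonneg ‖x‖]) (by linarith)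
  rw [Real.rpow_one] at h1
  rw [inv_mul_le_iff₀ (by positivity)]
  linarith

theorem bddOp_smul_resolventOp (n : ℕ) {l : ℝ} (hl : 0 ≤ l) (r : ℝ) :
    BddOp r r ((l : ℂ) • resolventOp n l) 1 := by
  have h5 := resolventSymbol_hasTemperateGrowth n hl
  rw [resolventOp, fourierOp, ← fourierMultiplierCLM_smul h5]
  refine bddOp_fourierOp
    ((Function.HasTemperateGrowth.const (l : ℂ)).mul h5) fun x => ?_
  rw [Pi.mul_apply, norm_mul, norm_resolventSymbol n hl, sub_self, zero_div, Real.rpow_zero,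
    mul_one, Complex.norm_real, Real.norm_of_nonneg hl, ← div_eq_mul_inv,
    div_le_one (by positivity)]
  nlinarith [sq_nonneg ‖x‖]

/-- The smoothing operators with which the equation is localized in frequency. -/
def freqOp (n : ℕ) (k : ℤ) (l : ℝ) : DistOp n :=
  resolventOp n l * (resolventOp n l * bessel n (2 * k : ℤ))

/-- With Q = l + G = R⁻¹ one has RER = [R,S], so moving R² past S produces RE + R²EQ on its left.
The factor Q is expanded into l and G so that each piece can be bounded uniformly in l, using
boundedness of lR in one and the two-derivative gains of R in the other. -/
theorem resolvent_sq_intertwine {𝓐 : Type*} [Ring 𝓐] [Algebra ℂ 𝓐] {S G R E : 𝓐} {l : ℂ}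
    (r1 : R * (l • 1 + G) = 1) (r2 : (l • 1 + G) * R = 1) (hE : E = S * G - G * S) :
    R * (R * S) = (S + R * E + l • R * (R * E) + R * (R * (E * G))) * (R * R) := by
  set Q := l • (1 : 𝓐) + G with hQ
  have e2 : E = S * Q - Q * S := by
    rw [hE, hQ, mul_add, add_mul, mul_smul_comm, smul_mul_assoc, mul_one, one_mul]
    abel
  have e3 : l • R * (R * E) + R * (R * (E * G)) = R * (R * E) * Q := by
    rw [hQ, mul_add, mul_smul_comm, mul_one, smul_mul_assoc]
    simp only [mul_assoc]
  have e4 : R * E * R = R * S - S * R := by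
    rw [e2, mul_sub, sub_mul]
    congr 1
    · rw [mul_assoc, mul_assoc, r2, mul_one]
    · rw [← mul_assoc, r1, one_mul]
  have e5 : R * (R * E) * Q * (R * R) = R * (R * S - S * R) := by
    rw [mul_assoc (R * (R * E)), ← mul_assoc Q, r2, one_mul, mul_assoc R, e4]
  rw [add_assoc, e3]
  symm
  calc (S + R * E + R * (R * E) * Q) * (R * R)
      = S * R * R + (R * E * R) * R + R * (R * E) * Q * (R * R) := by noncomm_ring
    _ = R * (R * S) := by rw [e5, e4]; noncomm_ring

/-- S is the conjugate Λ^{2k}TΛ^{-2k}. Its commutator with Λ² is the conjugate of [T,Λ²], hence of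
order 3 rather than 4. -/
theorem IsDiffLike.exists_commutator_bessel_conj {n : ℕ} {T : DistOp n} (hT : IsDiffLike 2 T)
    (k : ℤ) : ∃ S E : DistOp n, HasOrder 1 (S - T) ∧ HasOrder 3 E ∧
      E = S * bessel n 2 - bessel n 2 * S ∧
      bessel n (2 * k : ℤ) * T = S * bessel n (2 * k : ℤ) := by
  obtain ⟨J, hJ⟩ : ∃ J, J = bessel n (2 * k : ℤ) := ⟨_, rfl⟩
  obtain ⟨J', hJ'⟩ : ∃ J', J' = bessel n (-(2 * k : ℤ)) := ⟨_, rfl⟩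
  obtain ⟨G, hG⟩ : ∃ G, G = bessel n 2 := ⟨_, rfl⟩
  have eJ : J' * J = 1 := by
    rw [hJ, hJ', bessel_mul_bessel, neg_add_cancel, bessel_zero]
  have hB : HasOrder 1 (J * T * J' - T) := by
    rw [hJ, hJ']
    exact hT.bessel_conj_sub (by norm_num) k
  have hc : HasOrder 3 (T * G - G * T) := by
    rw [hG, ← neg_sub, ← neg_one_smul ℂ]
    exact (hT.commutator_bessel_two (by norm_num)).smul (-1)
  have h1 : HasOrder 3 (J * (T * G - G * T) * J') := by
    rw [hJ, hJ']
    exact hc.bessel_conj (2 * k)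
  have hGJ : G * J = J * G := by
    rw [hG, hJ, bessel_mul_bessel, bessel_mul_bessel, add_comm]
  have hGJ' : J' * G = G * J' := by
    rw [hG, hJ', bessel_mul_bessel, bessel_mul_bessel, add_comm]
  rw [← hJ, ← hG]
  clear hJ hJ' hG hT hc
  refine ⟨J * T * J', J * T * J' * G - G * (J * T * J'), hB, ?_, rfl, ?_⟩
  · have e : J * T * J' * G - G * (J * T * J') = J * (T * G - G * T) * J' := by
      rw [mul_assoc _ J' G, hGJ', ← mul_assoc G, ← mul_assoc G, hGJ]
      noncomm_ring
    rw [e]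
    exact h1
  · rw [mul_assoc, eJ, mul_one]

/-- The heart of the localization: C is chosen before l. All four terms of B map H_(1) to L²
uniformly: S − T has order 1, RE order 3 − 2, lR·RE again 3 − 2 as lR is bounded, and R²EΛ² order 5
− 4. -/
theorem IsDiffLike.exists_freqOp_mul {n : ℕ} {T : DistOp n} (hT : IsDiffLike 2 T) (k : ℤ) :
    ∃ C, ∀ l : ℝ, 0 ≤ l → ∃ B : DistOp n, BddOp 1 0 B C ∧
      freqOp n k l * T = (T + B) * freqOp n k l := by
  obtain ⟨S, E, hB, hEo, hE, hJ⟩ := hT.exists_commutator_bessel_conj k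
  have hEG : HasOrder 5 (E * bessel n 2) := by
    have := hasOrder_bessel n 2
    push_cast at this
    exact hEo.mul this rfl
  obtain ⟨C1, h1⟩ := hB 1
  obtain ⟨C2, h2⟩ := hEo 1
  obtain ⟨C3, h3⟩ := hEG 1
  norm_num at h1 h2 h3
  refine ⟨C1 + 1 * C2 + 1 * (1 * C2) + 1 * (1 * C3), fun l hl => ?_⟩
  obtain ⟨r1, r2⟩ := resolvent_mul_eq_one n hl
  have key := resolvent_sq_intertwine r1 r2 hE
  refine ⟨(S - T) + resolventOp n l * E + (l : ℂ) • resolventOp n l * (resolventOp n l * E) +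
    resolventOp n l * (resolventOp n l * (E * bessel n 2)), ?_, ?_⟩
  · refine BddOp.add (BddOp.add (BddOp.add h1 ?_) ?_) ?_
    · exact (bddOp_resolventOp n hl (by norm_num)).mul h2
    · exact (bddOp_smul_resolventOp n hl _).mul ((bddOp_resolventOp n hl (by norm_num)).mul h2)
    · exact (bddOp_resolventOp n hl (r := -2) (by norm_num)).mul
        ((bddOp_resolventOp n hl (by norm_num)).mul h3)
  · unfold freqOp
    generalize bessel n (2 * k : ℤ) = J at *
    generalize resolventOp n l = R at *
    generalize bessel n 2 = G at *
    calc R * (R * J) * T = R * (R * (J * T)) := by simp only [mul_assoc]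
      _ = R * (R * S) * J := by rw [hJ]; simp only [mul_assoc]
      _ = _ := by rw [key]; noncomm_ring

end DeSitterKG
end

/-! ### Scalar differential inequalities for the energy. -/

noncomputable section

namespace DeSitterKG

open MeasureTheory Filter Topology Set

/-! ### Energy inequalities -/

theorem le_of_hasDerivWithinAt_nonpos {f f' : ℝ → ℝ}
    (hf : ∀ t, 0 ≤ t → HasDerivWithinAt f (f' t) (Ici 0) t) {T : ℝ} (hT : 0 ≤ T)
    (hf' : ∀ t, T ≤ t → f' t ≤ 0) {t : ℝ} (ht : T ≤ t) : f t ≤ f T := by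
  have hs : Ici T ⊆ Ici (0 : ℝ) := Ici_subset_Ici.2 hT
  have hd : ∀ x, T < x → HasDerivAt f (f' x) x := fun x hx =>
    (hf x (hT.trans hx.le)).hasDerivAt (Ici_mem_nhds (hT.trans_lt hx))
  refine antitoneOn_of_deriv_nonpos (convex_Ici T)
    (fun x hx => ((hf x (hs hx)).continuousWithinAt).mono hs) ?_ ?_ (self_mem_Ici) ht ht
  · rw [interior_Ici]
    exact fun x hx => (hd x hx).differentiableAt.differentiableWithinAt
  · rw [interior_Ici]
    intro x hx
    rw [(hd x hx).deriv]
    exact hf' x (le_of_lt hx)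

theorem two_mul_abs_le_of_sq_le {c a N : ℝ} (ha : 0 ≤ a) (hN : 0 ≤ N) (h : c ^ 2 ≤ N * a) :
    2 * |c| ≤ N + a := by
  have : |2 * c| ≤ N + a := abs_le_of_sq_le_sq (by nlinarith [sq_nonneg (N - a)]) (by positivity)
  rwa [abs_mul, abs_two] at this

/-- The quantities attached to a solution `u` of `u'' = e^{-2t} g + μ u`: here `N = ‖u‖²`,
`a = ‖u'‖²`, `c = ⟪u, u'⟫` and `q` is the quadratic form of the principal part. -/
structure EnergyQuantities (K μ : ℝ) (N a c q ρ η θ : ℝ → ℝ) : Prop where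
  deriv_N : ∀ t, 0 ≤ t → HasDerivWithinAt N (2 * c t) (Ici 0) t
  deriv_a : ∀ t, 0 ≤ t → HasDerivWithinAt a
    (2 * (Real.exp (-2 * t) * (-ρ t + η t) + μ * c t)) (Ici 0) t
  deriv_c : ∀ t, 0 ≤ t → HasDerivWithinAt c
    (a t + (Real.exp (-2 * t) * (-q t + θ t) + μ * N t)) (Ici 0) t
  deriv_q : ∀ t, 0 ≤ t → HasDerivWithinAt q (2 * ρ t) (Ici 0) t
  N_nonneg : ∀ t, 0 ≤ t → 0 ≤ N t
  a_nonneg : ∀ t, 0 ≤ t → 0 ≤ a t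
  q_nonneg : ∀ t, 0 ≤ t → 0 ≤ q t
  c_sq : ∀ t, 0 ≤ t → c t ^ 2 ≤ N t * a t
  eta_sq : ∀ t, 0 ≤ t → η t ^ 2 ≤ K ^ 2 * (q t + N t) * a t
  abs_theta : ∀ t, 0 ≤ t → |θ t| ≤ K * (q t + N t)

namespace EnergyQuantities

variable {K μ : ℝ} {N a c q ρ η θ : ℝ → ℝ}

theorem hasDerivWithinAt_exp (b t : ℝ) :
    HasDerivWithinAt (fun t => Real.exp (b * t)) (b * Real.exp (b * t)) (Ici 0) t := by
  have := ((hasDerivAt_id t).const_mul b).exp.hasDerivWithinAt (s := Ici 0)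
  simpa [mul_comm] using this

/-- The energy. -/
def energy (μ : ℝ) (N a q : ℝ → ℝ) (t : ℝ) : ℝ :=
  a t + Real.exp (-2 * t) * (q t + N t) - μ * N t

theorem hasDerivWithinAt_energy (h : EnergyQuantities K μ N a c q ρ η θ) {t : ℝ} (ht : 0 ≤ t) :
    HasDerivWithinAt (energy μ N a q)
      (Real.exp (-2 * t) * (2 * η t - 2 * (q t + N t) + 2 * c t)) (Ici 0) t := by
  have := ((h.deriv_a t ht).add ((hasDerivWithinAt_exp (-2) t).mul
    ((h.deriv_q t ht).add (h.deriv_N t ht)))).sub ((h.deriv_N t ht).const_mul μ)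
  refine HasDerivWithinAt.congr_deriv (f := energy μ N a q) this ?_
  simp only [Pi.add_apply]
  ring

/-- Differentiating the weight e^{-2t} gives −2(q + N). Half of it absorbs the parts of 2η and 2c
that are not controlled by a. -/
theorem deriv_energy_le (h : EnergyQuantities K μ N a c q ρ η θ) {t : ℝ} (ht : 0 ≤ t) :
    2 * η t - 2 * (q t + N t) + 2 * c t ≤ -(q t + N t) + (2 * K ^ 2 + 2) * a t := by
  have hN := h.N_nonneg t ht
  have ha := h.a_nonneg t ht
  have hq := h.q_nonneg t ht
  have h1 : 2 * |η t| ≤ (q t + N t) / 2 + 2 * K ^ 2 * a t := by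
    refine two_mul_abs_le_of_sq_le (by positivity) (by positivity) ?_
    refine (h.eta_sq t ht).trans (le_of_eq (by ring))
  have h2 : 2 * |c t| ≤ N t / 2 + 2 * a t :=
    two_mul_abs_le_of_sq_le (by positivity) (by positivity)
      ((h.c_sq t ht).trans (le_of_eq (by ring)))
  have := le_abs_self (η t)
  have := le_abs_self (c t)
  linarith

/-- A crude Gronwall bound, used only on a bounded time interval. The weight |μ| + 1 + μ makes the
corrected energy dominate a + N whatever the sign of μ. -/
theorem growth (h : EnergyQuantities K μ N a c q ρ η θ) {t : ℝ} (ht : 0 ≤ t) :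
    energy μ N a q t + (|μ| + 1 + μ) * N t ≤
      Real.exp ((2 * K ^ 2 + 2 + (|μ| + 1 + μ)) * t) *
        (energy μ N a q 0 + (|μ| + 1 + μ) * N 0) := by
  set W := |μ| + 1 + μ with hW
  have hW0 : 0 ≤ W := by linarith [neg_abs_le μ]
  set M := 2 * K ^ 2 + 2 + W with hM
  have key := le_of_hasDerivWithinAt_nonpos (f := fun t => Real.exp (-M * t) *
    (energy μ N a q t + W * N t)) (T := 0) (fun s hs => (hasDerivWithinAt_exp (-M) s).mul
      ((h.hasDerivWithinAt_energy hs).add ((h.deriv_N s hs).const_mul W))) le_rfl ?_ ht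
  · rw [mul_zero, Real.exp_zero, one_mul] at key
    have h1 : Real.exp (M * t) * Real.exp (-M * t) = 1 := by
      rw [← Real.exp_add]; simp
    calc _ = Real.exp (M * t) * (Real.exp (-M * t) * (energy μ N a q t + W * N t)) := by
          rw [← mul_assoc, h1, one_mul]
      _ ≤ _ := by gcongr
  · intro s hs
    have hN := h.N_nonneg s hs
    have ha := h.a_nonneg s hs
    have hq := h.q_nonneg s hs
    have h1 := h.deriv_energy_le hs
    have h2 := two_mul_abs_le_of_sq_le ha hN (h.c_sq s hs)
    have h3 : W * (2 * c s) ≤ W * (N s + a s) := by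
      gcongr; linarith [le_abs_self (c s)]
    have he0 := Real.exp_pos (-2 * s)
    have he1 : Real.exp (-2 * s) ≤ 1 := Real.exp_le_one_iff.2 (by linarith)
    have h4 : Real.exp (-2 * s) * (2 * η s - 2 * (q s + N s) + 2 * c s) ≤
        (2 * K ^ 2 + 2) * a s := by
      calc _ ≤ Real.exp (-2 * s) * ((2 * K ^ 2 + 2) * a s) := by
            gcongr; linarith
        _ ≤ 1 * ((2 * K ^ 2 + 2) * a s) := by gcongr
        _ = _ := one_mul _
    have h5 : M * (a s + N s) ≤ M * (energy μ N a q s + W * N s) := by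
      have : 0 ≤ |μ| * N s := by positivity
      have : 0 ≤ Real.exp (-2 * s) * (q s + N s) := by positivity
      refine mul_le_mul_of_nonneg_left ?_ (by positivity)
      rw [energy, hW]
      linarith
    have h6 : 0 ≤ (2 * K ^ 2 + 2) * N s := by positivity
    have h7 : Real.exp (-2 * s) * (2 * η s - 2 * (q s + N s) + 2 * c s) + W * (2 * c s) ≤
        M * (energy μ N a q s + W * N s) := by
      rw [hM] at h5 ⊢
      linarith
    have h8 := mul_le_mul_of_nonneg_left h7 (Real.exp_pos (-M * s)).le
    linarith

/-- Here a is at most the energy, so the energy grows at rate at most (2K² + 2)e^{-2t}, whose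
integral over [0,∞) is K² + 1. -/
theorem bound_of_nonpos (h : EnergyQuantities K μ N a c q ρ η θ) (hμ : μ ≤ 0) {t : ℝ}
    (ht : 0 ≤ t) : energy μ N a q t ≤ Real.exp (K ^ 2 + 1) * energy μ N a q 0 := by
  have hd : ∀ s : ℝ, HasDerivWithinAt (fun t => Real.exp ((K ^ 2 + 1) * Real.exp (-2 * t)))
      (-((2 * K ^ 2 + 2) * Real.exp (-2 * s)) * Real.exp ((K ^ 2 + 1) * Real.exp (-2 * s)))
      (Ici 0) s := by
    intro s
    convert ((hasDerivWithinAt_exp (-2) s).const_mul (K ^ 2 + 1)).exp using 1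
    ring
  have hE : ∀ s, 0 ≤ s → a s ≤ energy μ N a q s ∧ 0 ≤ energy μ N a q s := by
    intro s hs
    have hN := h.N_nonneg s hs
    have ha := h.a_nonneg s hs
    have hq := h.q_nonneg s hs
    have : 0 ≤ Real.exp (-2 * s) * (q s + N s) := by positivity
    have : 0 ≤ -μ * N s := mul_nonneg (by linarith) hN
    constructor <;> (rw [energy]; linarith)
  have key := le_of_hasDerivWithinAt_nonpos (T := 0) (fun s hs => (hd s).mul
    (h.hasDerivWithinAt_energy hs)) le_rfl ?_ ht
  · simp only [Pi.mul_apply, mul_zero, Real.exp_zero, mul_one] at key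
    refine le_trans ?_ key
    exact le_mul_of_one_le_left (hE t ht).2 (Real.one_le_exp (by positivity))
  · intro s hs
    have hN := h.N_nonneg s hs
    have hq := h.q_nonneg s hs
    have h1 : Real.exp (-2 * s) * (2 * η s - 2 * (q s + N s) + 2 * c s) ≤
        Real.exp (-2 * s) * ((2 * K ^ 2 + 2) * energy μ N a q s) := by
      have := h.deriv_energy_le hs
      have : (2 * K ^ 2 + 2) * a s ≤ (2 * K ^ 2 + 2) * energy μ N a q s := by
        have := (hE s hs).1
        gcongr
      gcongr
      linarith
    have h2 := mul_le_mul_of_nonneg_left h1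
      (Real.exp_pos ((K ^ 2 + 1) * Real.exp (-2 * s))).le
    linarith

/-- The energy no longer controls a, so 2k e^{-αt}c is subtracted from it. The derivative of this
correction yields −k e^{-αt}a, which beats the error (2K² + 2)e^{-2t}a once t ≥ T, while its
contribution e^{-2t}(q − θ) is absorbed by the term −e^{-2t}(q + N). -/
theorem bound_of_pos (h : EnergyQuantities K μ N a c q ρ η θ) (hK : 0 ≤ K) (hμ : 0 < μ)
    {T : ℝ} (hT : 0 ≤ T)
    (hTK : (2 * K ^ 2 + 2) * Real.exp (-T) ≤ 1 / (4 * (K + 1))) {t : ℝ} (ht : T ≤ t) :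
    3 / 4 * (a t + Real.exp (-2 * t) * (q t + N t)) ≤
      2 * (energy μ N a q T + (|μ| + 1 + μ) * N T) + (μ + 1) * N t := by
  obtain ⟨k, hk⟩ : ∃ k, k = 1 / (4 * (K + 1)) := ⟨_, rfl⟩
  rw [← hk] at hTK
  have hk0 : 0 < k := by rw [hk]; positivity
  have hk2 : 4 * k * (K + 1) = 1 := by rw [hk]; field_simp
  have hk1 : 4 * k ≤ 1 := by nlinarith
  -- α² ≤ μ gives αc ≤ (μN + a)/2, and α ≤ 1 gives e^{-t} ≤ e^{-αt}; nothing else about α is used.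
  obtain ⟨α, hα0, hα1, hαμ⟩ : ∃ α : ℝ, 0 ≤ α ∧ α ≤ 1 ∧ α ^ 2 ≤ μ := by
    refine ⟨min 1 (Real.sqrt μ), by positivity, min_le_left _ _, ?_⟩
    calc _ ≤ Real.sqrt μ ^ 2 := by
          gcongr; exact min_le_right _ _
      _ = μ := Real.sq_sqrt hμ.le
  have hec : ∀ s, 0 ≤ s → 2 * k * |Real.exp (-α * s) * c s| ≤ (N s + a s) / 4 := by
    intro s hs
    have hN := h.N_nonneg s hs
    have ha := h.a_nonneg s hs
    have h2 := two_mul_abs_le_of_sq_le ha hN (h.c_sq s hs)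
    have he : Real.exp (-α * s) ≤ 1 := Real.exp_le_one_iff.2 (by nlinarith)
    rw [abs_mul, abs_of_pos (Real.exp_pos _)]
    have h3 : Real.exp (-α * s) * |c s| ≤ 1 * |c s| := by gcongr
    nlinarith
  have key := le_of_hasDerivWithinAt_nonpos (f := fun t => energy μ N a q t -
    2 * k * (Real.exp (-α * t) * c t)) (T := T) (fun s hs => (h.hasDerivWithinAt_energy hs).sub
      (((hasDerivWithinAt_exp (-α) s).mul (h.deriv_c s hs)).const_mul (2 * k))) hT ?_ ht
  · have ht0 := hT.trans ht
    have h1 := hec t ht0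
    have h2 := hec T hT
    have h3 := le_abs_self (Real.exp (-α * t) * c t)
    have h4 := neg_abs_le (Real.exp (-α * T) * c T)
    have hN := h.N_nonneg t ht0
    have ha := h.a_nonneg t ht0
    have hq := h.q_nonneg t ht0
    have hNT := h.N_nonneg T hT
    have haT := h.a_nonneg T hT
    have hqT := h.q_nonneg T hT
    have h5 : 2 * k * (Real.exp (-α * t) * c t) ≤ (N t + a t) / 4 := by
      refine le_trans ?_ h1
      gcongr
    have h6 : -(2 * k * (Real.exp (-α * T) * c T)) ≤ (N T + a T) / 4 := by
      refine le_trans ?_ h2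
      rw [← mul_neg]
      gcongr
      exact neg_le_abs _
    have h7 : 0 ≤ Real.exp (-2 * t) * (q t + N t) := by positivity
    have h8 : 0 ≤ Real.exp (-2 * T) * (q T + N T) := by positivity
    have h9 : 0 ≤ μ * N T := by positivity
    rw [abs_of_pos hμ]
    simp only [energy] at key ⊢
    linarith
  · intro s hs
    have hs0 := hT.trans hs
    have hN := h.N_nonneg s hs0
    have ha := h.a_nonneg s hs0
    have hq := h.q_nonneg s hs0
    have h1 := h.deriv_energy_le hs0
    have he2 := Real.exp_pos (-2 * s)
    have hea := Real.exp_pos (-α * s)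
    have hea1 : Real.exp (-α * s) ≤ 1 := Real.exp_le_one_iff.2 (by nlinarith)
    have h2 : Real.exp (-2 * s) * (2 * K ^ 2 + 2) ≤ k * Real.exp (-α * s) := by
      have e1 : Real.exp (-2 * s) = Real.exp (-s) * Real.exp (-s) := by
        rw [← Real.exp_add]; ring_nf
      have e2 : Real.exp (-s) ≤ Real.exp (-T) := Real.exp_le_exp.2 (by linarith)
      have e3 : Real.exp (-s) ≤ Real.exp (-α * s) := Real.exp_le_exp.2 (by nlinarith)
      calc _ = ((2 * K ^ 2 + 2) * Real.exp (-s)) * Real.exp (-s) := by rw [e1]; ring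
        _ ≤ ((2 * K ^ 2 + 2) * Real.exp (-T)) * Real.exp (-α * s) := by gcongr
        _ ≤ _ := by gcongr
    have h3 : α * c s ≤ (μ * N s + a s) / 2 := by
      have := two_mul_abs_le_of_sq_le (c := α * c s) ha (by positivity : 0 ≤ μ * N s) (by
        have := h.c_sq s hs0
        calc (α * c s) ^ 2 = α ^ 2 * c s ^ 2 := by ring
          _ ≤ μ * (N s * a s) := by gcongr
          _ = _ := by ring)
      linarith [le_abs_self (α * c s)]
    have h4 : q s - θ s ≤ (K + 1) * (q s + N s) := by
      have := h.abs_theta s hs0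
      linarith [neg_abs_le (θ s)]
    have p1 : Real.exp (-2 * s) * (2 * η s - 2 * (q s + N s) + 2 * c s) ≤
        -(Real.exp (-2 * s) * (q s + N s)) + k * Real.exp (-α * s) * a s := by
      calc _ ≤ Real.exp (-2 * s) * (-(q s + N s) + (2 * K ^ 2 + 2) * a s) := by gcongr
        _ = -(Real.exp (-2 * s) * (q s + N s)) +
            Real.exp (-2 * s) * (2 * K ^ 2 + 2) * a s := by ring
        _ ≤ _ := by gcongr
    have p2 : 2 * k * (Real.exp (-α * s) * (a s - α * c s + μ * N s)) ≥
        k * Real.exp (-α * s) * a s := by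
      have : a s / 2 ≤ a s - α * c s + μ * N s := by
        have : 0 ≤ μ * N s := by positivity
        linarith
      calc 2 * k * (Real.exp (-α * s) * (a s - α * c s + μ * N s)) ≥
          2 * k * (Real.exp (-α * s) * (a s / 2)) := by
            gcongr
        _ = _ := by ring
    have p3 : 2 * k * (Real.exp (-α * s) * (Real.exp (-2 * s) * (q s - θ s))) ≤
        Real.exp (-2 * s) * (q s + N s) := by
      calc _ ≤ 2 * k * (Real.exp (-α * s) * (Real.exp (-2 * s) * ((K + 1) * (q s + N s)))) := by
            gcongr
        _ ≤ 2 * k * (1 * (Real.exp (-2 * s) * ((K + 1) * (q s + N s)))) := by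
            gcongr
        _ = (4 * k * (K + 1)) / 2 * (Real.exp (-2 * s) * (q s + N s)) := by ring
        _ ≤ 1 * (Real.exp (-2 * s) * (q s + N s)) := by
            rw [hk2]; gcongr; norm_num
        _ = _ := one_mul _
    linarith

end EnergyQuantities

/-- For μ > 0 the time T depends only on K, so `growth` up to T followed by `bound_of_pos` keeps the
constant independent of the solution. -/
theorem exists_energy_bound (K μ : ℝ) (hK : 0 ≤ K) :
    ∃ C, 0 < C ∧ ∀ N a c q ρ η θ : ℝ → ℝ, EnergyQuantities K μ N a c q ρ η θ → ∀ t, 0 ≤ t →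
      a t + Real.exp (-2 * t) * (q t + N t) ≤ C * (N t + (a 0 + q 0 + N 0)) := by
  have h0 : ∀ {N a c q ρ η θ : ℝ → ℝ}, EnergyQuantities K μ N a c q ρ η θ →
      0 ≤ N 0 ∧ 0 ≤ a 0 ∧ 0 ≤ q 0 := fun h =>
    ⟨h.N_nonneg 0 le_rfl, h.a_nonneg 0 le_rfl, h.q_nonneg 0 le_rfl⟩
  rcases le_or_gt μ 0 with hμ | hμ
  · refine ⟨Real.exp (K ^ 2 + 1) * (1 - μ), by
      have : 0 < 1 - μ := by linarith
      positivity, ?_⟩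
    intro N a c q ρ η θ h t ht
    have h1 := h.bound_of_nonpos hμ ht
    obtain ⟨hN0, ha0, hq0⟩ := h0 h
    have hN := h.N_nonneg t ht
    have h2 : EnergyQuantities.energy μ N a q 0 ≤ (1 - μ) * (N t + (a 0 + q 0 + N 0)) := by
      simp only [EnergyQuantities.energy, mul_zero, Real.exp_zero, one_mul]
      nlinarith
    calc _ ≤ EnergyQuantities.energy μ N a q t := by
          rw [EnergyQuantities.energy]; nlinarith
      _ ≤ _ := h1
      _ ≤ Real.exp (K ^ 2 + 1) * ((1 - μ) * (N t + (a 0 + q 0 + N 0))) := by gcongr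
      _ = _ := by ring
  · obtain ⟨T, hT, hTK⟩ : ∃ T : ℝ, 0 ≤ T ∧
        (2 * K ^ 2 + 2) * Real.exp (-T) ≤ 1 / (4 * (K + 1)) := by
      have h1 : 0 < (2 * K ^ 2 + 2) * (4 * (K + 1)) := by positivity
      refine ⟨max 0 (Real.log ((2 * K ^ 2 + 2) * (4 * (K + 1)))), le_max_left _ _, ?_⟩
      have h2 : Real.exp (-max 0 (Real.log ((2 * K ^ 2 + 2) * (4 * (K + 1))))) ≤
          ((2 * K ^ 2 + 2) * (4 * (K + 1)))⁻¹ := by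
        calc _ ≤ Real.exp (-Real.log ((2 * K ^ 2 + 2) * (4 * (K + 1)))) :=
              Real.exp_le_exp.2 (neg_le_neg (le_max_right _ _))
          _ = _ := by rw [Real.exp_neg, Real.exp_log h1]
      calc _ ≤ (2 * K ^ 2 + 2) * ((2 * K ^ 2 + 2) * (4 * (K + 1)))⁻¹ := by gcongr
        _ = _ := by field_simp
    set W := |μ| + 1 + μ with hW
    have hW0 : 0 ≤ W := by positivity
    set M := 2 * K ^ 2 + 2 + W with hM
    have hM0 : 0 ≤ M := by positivity
    refine ⟨4 * Real.exp (M * T) * (1 + W) + 4 * (μ + 1), by positivity, ?_⟩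
    intro N a c q ρ η θ h t ht
    obtain ⟨hN0, ha0, hq0⟩ := h0 h
    have hN := h.N_nonneg t ht
    have ha := h.a_nonneg t ht
    have hq := h.q_nonneg t ht
    have hD : 0 ≤ a 0 + q 0 + N 0 := by positivity
    have hS0 : EnergyQuantities.energy μ N a q 0 + W * N 0 ≤
        (1 + W) * (a 0 + q 0 + N 0) := by
      simp only [EnergyQuantities.energy, mul_zero, Real.exp_zero, one_mul]
      nlinarith
    have hS : ∀ s, 0 ≤ s → s ≤ T → EnergyQuantities.energy μ N a q s + W * N s ≤
        Real.exp (M * T) * ((1 + W) * (a 0 + q 0 + N 0)) := by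
      intro s hs hsT
      refine (h.growth hs).trans ?_
      calc _ ≤ Real.exp (M * s) * ((1 + W) * (a 0 + q 0 + N 0)) := by gcongr
        _ ≤ _ := by gcongr
    have hp : 0 ≤ Real.exp (M * T) * ((1 + W) * (a 0 + q 0 + N 0)) := by positivity
    have hp2 : 0 ≤ Real.exp (M * T) * (1 + W) * N t := by positivity
    have hp3 : 0 ≤ (μ + 1) * (a 0 + q 0 + N 0) := by positivity
    have hp4 : 0 ≤ (μ + 1) * N t := by positivity
    rcases le_total t T with htT | htT
    · have := hS t ht htT
      have hμN : 0 ≤ |μ| * N t := by positivity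
      rw [EnergyQuantities.energy, hW] at this
      linarith
    · have h1 := h.bound_of_pos hK hμ hT hTK htT
      have h2 := hS T hT le_rfl
      rw [← hW] at h1
      have h3 : 0 ≤ Real.exp (-2 * t) * (q t + N t) := by positivity
      linarith

end DeSitterKG
end

/-! ### Energy estimates in Hilbert space, integration by parts and coercivity in L². -/

noncomputable section

namespace DeSitterKG

open MeasureTheory Filter Topology Set TemperedDistribution FourierTransform

theorem sq_add_sum_le {ι : Type*} [Fintype ι] (x : ℝ) (y : ι → ℝ) :
    (x + ∑ i, y i) ^ 2 ≤ (1 + Fintype.card ι) * (x ^ 2 + ∑ i, y i ^ 2) := by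
  have := sq_sum_le_card_mul_sum_sq (s := Finset.univ)
    (f := fun o : Option ι => o.elim x y)
  simpa [Fintype.sum_option, add_comm] using this

/-- The energy inequality for a second order equation in a Hilbert space. -/
theorem exists_hilbert_energy_bound {ι H : Type*} [Fintype ι] [NormedAddCommGroup H]
    [InnerProductSpace ℝ H] (M : ι → ι → H →L[ℝ] H)
    (hM : ∀ i j x y, inner ℝ (M i j x) y = inner ℝ x (M j i y)) {δ : ℝ} (hδ : 0 < δ)
    (hco : ∀ X : ι → H, δ * ∑ i, ‖X i‖ ^ 2 ≤ ∑ i, ∑ j, inner ℝ (M i j (X j)) (X i))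
    {K : ℝ} (hK : 0 ≤ K) (μ : ℝ) :
    ∃ C, 0 < C ∧ ∀ (u u₁ u₂ g b : ℝ → H) (U U₁ : ι → ℝ → H),
      (∀ t, 0 ≤ t → HasDerivWithinAt u (u₁ t) (Ici 0) t) →
      (∀ t, 0 ≤ t → HasDerivWithinAt u₁ (u₂ t) (Ici 0) t) →
      (∀ i t, 0 ≤ t → HasDerivWithinAt (U i) (U₁ i t) (Ici 0) t) →
      (∀ t, 0 ≤ t → u₂ t = Real.exp (-2 * t) • g t + μ • u t) →
      (∀ t, 0 ≤ t → ‖b t‖ ≤ K * (‖u t‖ + ∑ i, ‖U i t‖)) →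
      (∀ t, 0 ≤ t → inner ℝ (g t) (u t) =
        -(∑ i, ∑ j, inner ℝ (M i j (U j t)) (U i t)) + inner ℝ (b t) (u t)) →
      (∀ t, 0 ≤ t → inner ℝ (g t) (u₁ t) =
        -(∑ i, ∑ j, inner ℝ (M i j (U j t)) (U₁ i t)) + inner ℝ (b t) (u₁ t)) →
      ∀ t, 0 ≤ t → ‖u₁ t‖ ^ 2 + Real.exp (-2 * t) * (‖u t‖ ^ 2 + ∑ i, ‖U i t‖ ^ 2) ≤
        C * (‖u t‖ ^ 2 + (‖u₁ 0‖ ^ 2 + ‖u 0‖ ^ 2 + ∑ i, ‖U i 0‖ ^ 2)) := by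
  -- d compares ‖x‖² + ∑‖X i‖² with the quadratic form plus ‖x‖²; `K0` adds the Cauchy–Schwarz
  -- factor 1 + card ι needed to square the bound on b.
  obtain ⟨d, hd⟩ : ∃ d : ℝ, d = 1 + 1 / δ := ⟨_, rfl⟩
  have hd1 : 1 ≤ d := by rw [hd]; linarith [one_div_pos.2 hδ]
  obtain ⟨K0, hK0⟩ : ∃ K0 : ℝ, K0 = (1 + Fintype.card ι) * d := ⟨_, rfl⟩
  have hK01 : 1 ≤ K0 := by
    rw [hK0]
    have : (0 : ℝ) ≤ Fintype.card ι := by positivity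
    nlinarith
  obtain ⟨m, hm⟩ : ∃ m : ℝ, m = ∑ i, ∑ j, ‖M i j‖ := ⟨_, rfl⟩
  have hm0 : 0 ≤ m := by rw [hm]; positivity
  have hQ : ∀ X : ι → H, ∑ i, ‖X i‖ ^ 2 ≤ (1 / δ) * ∑ i, ∑ j, inner ℝ (M i j (X j)) (X i) := by
    intro X
    rw [one_div, ← div_eq_inv_mul, le_div_iff₀ hδ, mul_comm]
    exact hco X
  have hQ0 : ∀ X : ι → H, 0 ≤ ∑ i, ∑ j, inner ℝ (M i j (X j)) (X i) := fun X =>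
    le_trans (by positivity) (hco X)
  have hQF : ∀ (x : H) (X : ι → H), ‖x‖ ^ 2 + ∑ i, ‖X i‖ ^ 2 ≤
      d * ((∑ i, ∑ j, inner ℝ (M i j (X j)) (X i)) + ‖x‖ ^ 2) := by
    intro x X
    have h1 := hQ X
    have h2 := hQ0 X
    have h3 : 0 ≤ 1 / δ * ‖x‖ ^ 2 := by positivity
    rw [hd]
    linarith
  have hQm : ∀ X : ι → H, ∑ i, ∑ j, inner ℝ (M i j (X j)) (X i) ≤ m * ∑ i, ‖X i‖ ^ 2 := by
    intro X
    rw [hm, Finset.sum_mul]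
    refine Finset.sum_le_sum fun i _ => ?_
    rw [Finset.sum_mul]
    refine Finset.sum_le_sum fun j _ => ?_
    have hk : ∀ k, ‖X k‖ ≤ Real.sqrt (∑ i, ‖X i‖ ^ 2) := fun k =>
      Real.le_sqrt_of_sq_le (Finset.single_le_sum (f := fun i => ‖X i‖ ^ 2)
        (fun i _ => by positivity) (Finset.mem_univ k))
    calc inner ℝ (M i j (X j)) (X i) ≤ ‖M i j (X j)‖ * ‖X i‖ := real_inner_le_norm _ _
      _ ≤ (‖M i j‖ * ‖X j‖) * ‖X i‖ := by gcongr; exact (M i j).le_opNorm _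
      _ ≤ (‖M i j‖ * Real.sqrt (∑ i, ‖X i‖ ^ 2)) * Real.sqrt (∑ i, ‖X i‖ ^ 2) := by
          gcongr
          exacts [hk j, hk i]
      _ = _ := by rw [mul_assoc, Real.mul_self_sqrt (by positivity)]
  obtain ⟨C, hC, h⟩ := exists_energy_bound (K * K0) μ (by positivity)
  refine ⟨d * C * (1 + m), by positivity, ?_⟩
  intro u u₁ u₂ g b U U₁ du du₁ dU heq hb hg hg₁ t ht
  have hb2 : ∀ t, 0 ≤ t → ‖b t‖ ^ 2 ≤ (K * K0) ^ 2 *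
      ((∑ i, ∑ j, inner ℝ (M i j (U j t)) (U i t)) + ‖u t‖ ^ 2) := by
    intro t ht
    have h1 := sq_add_sum_le ‖u t‖ (fun i => ‖U i t‖)
    have h2 := hQF (u t) (fun i => U i t)
    have h3 := hQ0 (fun i => U i t)
    calc ‖b t‖ ^ 2 ≤ (K * (‖u t‖ + ∑ i, ‖U i t‖)) ^ 2 := by gcongr; exact hb t ht
      _ = K ^ 2 * (‖u t‖ + ∑ i, ‖U i t‖) ^ 2 := by ring
      _ ≤ K ^ 2 * ((1 + Fintype.card ι) *
          (d * ((∑ i, ∑ j, inner ℝ (M i j (U j t)) (U i t)) + ‖u t‖ ^ 2))) := by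
          gcongr
          exact h1.trans (by gcongr)
      _ = K ^ 2 * K0 * ((∑ i, ∑ j, inner ℝ (M i j (U j t)) (U i t)) + ‖u t‖ ^ 2) := by
          rw [hK0]; ring
      _ ≤ (K * K0) ^ 2 * ((∑ i, ∑ j, inner ℝ (M i j (U j t)) (U i t)) + ‖u t‖ ^ 2) := by
          rw [mul_pow]
          have : K0 ≤ K0 ^ 2 := by nlinarith
          gcongr
  have key := h (fun t => ‖u t‖ ^ 2) (fun t => ‖u₁ t‖ ^ 2) (fun t => inner ℝ (u t) (u₁ t))
    (fun t => ∑ i, ∑ j, inner ℝ (M i j (U j t)) (U i t))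
    (fun t => ∑ i, ∑ j, inner ℝ (M i j (U j t)) (U₁ i t))
    (fun t => inner ℝ (b t) (u₁ t)) (fun t => inner ℝ (b t) (u t))
    { deriv_N := fun t ht => (du t ht).norm_sq
      deriv_a := fun t ht => by
        refine (du₁ t ht).norm_sq.congr_deriv ?_
        rw [heq t ht, inner_add_right, inner_smul_right, inner_smul_right,
          real_inner_comm (g t), hg₁ t ht, real_inner_comm (u t)]
      deriv_c := fun t ht => by
        refine ((du t ht).inner ℝ (du₁ t ht)).congr_deriv ?_
        rw [heq t ht, inner_add_right, inner_smul_right, inner_smul_right,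
          real_inner_comm (g t), hg t ht, real_inner_self_eq_norm_sq, real_inner_self_eq_norm_sq]
        ring
      deriv_q := fun t ht => by
        have h1 : ∀ i j, HasDerivWithinAt (fun t => inner ℝ (M i j (U j t)) (U i t))
            (inner ℝ (M i j (U j t)) (U₁ i t) + inner ℝ (M i j (U₁ j t)) (U i t)) (Ici 0) t :=
          fun i j => ((M i j).hasFDerivAt.comp_hasDerivWithinAt t (dU j t ht)).inner ℝ (dU i t ht)
        refine (HasDerivWithinAt.fun_sum fun i _ => HasDerivWithinAt.fun_sum
          fun j _ => h1 i j).congr_deriv ?_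
        -- The adjoint of `M i j` is `M j i`, so both halves of the derivative of q agree.
        have h2 : ∑ i, ∑ j, inner ℝ (M i j (U₁ j t)) (U i t) =
            ∑ i, ∑ j, inner ℝ (M i j (U j t)) (U₁ i t) := by
          rw [Finset.sum_comm]
          exact Finset.sum_congr rfl fun i _ => Finset.sum_congr rfl fun j _ => by
            rw [hM, real_inner_comm]
        simp only [Finset.sum_add_distrib]
        rw [h2]
        ring
      N_nonneg := fun t _ => by positivity
      a_nonneg := fun t _ => by positivity
      q_nonneg := fun t _ => hQ0 (fun i => U i t)
      c_sq := fun t _ => by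
        rw [← mul_pow]
        exact sq_le_sq' (by linarith [neg_abs_le (inner ℝ (u t) (u₁ t)),
          abs_real_inner_le_norm (u t) (u₁ t)]) (real_inner_le_norm _ _)
      eta_sq := fun t ht => by
        calc (inner ℝ (b t) (u₁ t)) ^ 2 ≤ (‖b t‖ * ‖u₁ t‖) ^ 2 :=
              sq_le_sq' (by linarith [neg_abs_le (inner ℝ (b t) (u₁ t)),
                abs_real_inner_le_norm (b t) (u₁ t)]) (real_inner_le_norm _ _)
          _ = ‖b t‖ ^ 2 * ‖u₁ t‖ ^ 2 := by ring
          _ ≤ _ := by gcongr; exact hb2 t ht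
      abs_theta := fun t ht => by
        have h3 := hQ0 (fun i => U i t)
        refine abs_le_of_sq_le_sq ?_ (by positivity)
        calc (inner ℝ (b t) (u t)) ^ 2 ≤ (‖b t‖ * ‖u t‖) ^ 2 :=
              sq_le_sq' (by linarith [neg_abs_le (inner ℝ (b t) (u t)),
                abs_real_inner_le_norm (b t) (u t)]) (real_inner_le_norm _ _)
          _ = ‖b t‖ ^ 2 * ‖u t‖ ^ 2 := by ring
          _ ≤ ((K * K0) ^ 2 * ((∑ i, ∑ j, inner ℝ (M i j (U j t)) (U i t)) + ‖u t‖ ^ 2)) *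
              ((∑ i, ∑ j, inner ℝ (M i j (U j t)) (U i t)) + ‖u t‖ ^ 2) := by
              gcongr
              · exact hb2 t ht
              · linarith
          _ = _ := by ring } t ht
  have h1 := hQF (u t) (fun i => U i t)
  have h2 := hQm (fun i => U i 0)
  have h5 : 0 ≤ m * ‖u t‖ ^ 2 := by positivity
  have h6 : 0 ≤ m * ‖u₁ 0‖ ^ 2 := by positivity
  have h7 : 0 ≤ m * ‖u 0‖ ^ 2 := by positivity
  have h8 : 0 ≤ ∑ i, ‖U i 0‖ ^ 2 := by positivity
  calc _ ≤ d * ‖u₁ t‖ ^ 2 + Real.exp (-2 * t) *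
        (d * ((∑ i, ∑ j, inner ℝ (M i j (U j t)) (U i t)) + ‖u t‖ ^ 2)) := by
        gcongr
        exact le_mul_of_one_le_left (by positivity) hd1
    _ = d * (‖u₁ t‖ ^ 2 + Real.exp (-2 * t) *
        ((∑ i, ∑ j, inner ℝ (M i j (U j t)) (U i t)) + ‖u t‖ ^ 2)) := by ring
    _ ≤ d * (C * ((1 + m) *
        (‖u t‖ ^ 2 + (‖u₁ 0‖ ^ 2 + ‖u 0‖ ^ 2 + ∑ i, ‖U i 0‖ ^ 2)))) := by
        refine mul_le_mul_of_nonneg_left (key.trans ?_) (by positivity)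
        refine mul_le_mul_of_nonneg_left ?_ hC.le
        linarith
    _ = _ := by ring

/-- The energy inequality for a damped second order equation in a Hilbert space. -/
theorem exists_damped_energy_bound {ι H : Type*} [Fintype ι] [NormedAddCommGroup H]
    [InnerProductSpace ℝ H] (M : ι → ι → H →L[ℝ] H)
    (hM : ∀ i j x y, inner ℝ (M i j x) y = inner ℝ x (M j i y)) {δ : ℝ} (hδ : 0 < δ)
    (hco : ∀ X : ι → H, δ * ∑ i, ‖X i‖ ^ 2 ≤ ∑ i, ∑ j, inner ℝ (M i j (X j)) (X i))
    {K : ℝ} (hK : 0 ≤ K) (ν m2 : ℝ) :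
    ∃ C, 0 < C ∧ ∀ (v w z g b : ℝ → H) (V W : ι → ℝ → H),
      (∀ t, 0 ≤ t → HasDerivWithinAt v (w t) (Ici 0) t) →
      (∀ t, 0 ≤ t → HasDerivWithinAt w (z t) (Ici 0) t) →
      (∀ i t, 0 ≤ t → HasDerivWithinAt (V i) (W i t) (Ici 0) t) →
      (∀ t, 0 ≤ t → z t + ν • w t + m2 • v t = Real.exp (-2 * t) • g t) →
      (∀ t, 0 ≤ t → ‖b t‖ ≤ K * (‖v t‖ + ∑ i, ‖V i t‖)) →
      (∀ t, 0 ≤ t → inner ℝ (g t) (v t) =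
        -(∑ i, ∑ j, inner ℝ (M i j (V j t)) (V i t)) + inner ℝ (b t) (v t)) →
      (∀ t, 0 ≤ t → inner ℝ (g t) (w t) =
        -(∑ i, ∑ j, inner ℝ (M i j (V j t)) (W i t)) + inner ℝ (b t) (w t)) →
      ∀ t, 0 ≤ t → ‖w t‖ ^ 2 + Real.exp (-2 * t) * (‖v t‖ ^ 2 + ∑ i, ‖V i t‖ ^ 2) ≤
        C * (‖v t‖ ^ 2 +
          Real.exp (-ν * t) * (‖w 0‖ ^ 2 + ‖v 0‖ ^ 2 + ∑ i, ‖V i 0‖ ^ 2)) := by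
  obtain ⟨C, hC, h⟩ := exists_hilbert_energy_bound M hM hδ hco hK (ν ^ 2 / 4 - m2)
  refine ⟨2 * (C * (ν ^ 2 + 2)) + ν ^ 2, by positivity, ?_⟩
  intro v w z g b V W dv dw dV heq hb hg hg₁ t ht
  have hexp : ∀ t : ℝ, HasDerivWithinAt (fun t => Real.exp (ν / 2 * t))
      (ν / 2 * Real.exp (ν / 2 * t)) (Ici 0) t :=
    EnergyQuantities.hasDerivWithinAt_exp (ν / 2)
  -- u = e^{νt/2}v has no first order term in time, and its zero order coefficient is ν²/4 − m².
  have key := h (fun t => Real.exp (ν / 2 * t) • v t)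
    (fun t => Real.exp (ν / 2 * t) • (w t + (ν / 2) • v t))
    (fun t => Real.exp (ν / 2 * t) • (z t + ν • w t + (ν ^ 2 / 4) • v t))
    (fun t => Real.exp (ν / 2 * t) • g t) (fun t => Real.exp (ν / 2 * t) • b t)
    (fun i t => Real.exp (ν / 2 * t) • V i t)
    (fun i t => Real.exp (ν / 2 * t) • (W i t + (ν / 2) • V i t))
    (fun t ht => by
      refine ((hexp t).smul (dv t ht)).congr_deriv ?_
      module)
    (fun t ht => by
      refine ((hexp t).smul ((dw t ht).add ((dv t ht).const_smul (ν / 2)))).congr_deriv ?_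
      simp only [Pi.add_apply, Pi.smul_apply]
      module)
    (fun i t ht => by
      refine ((hexp t).smul (dV i t ht)).congr_deriv ?_
      module)
    (fun t ht => by
      have h1 : z t + ν • w t + (ν ^ 2 / 4) • v t =
          Real.exp (-2 * t) • g t + (ν ^ 2 / 4 - m2) • v t := by
        rw [← heq t ht]; module
      rw [h1]
      module)
    (fun t ht => by
      simp only [norm_smul, ← Finset.mul_sum, ← mul_add]
      rw [mul_left_comm]
      gcongr
      exact hb t ht)
    (fun t ht => by
      simp only [map_smul, inner_smul_left, inner_smul_right, ← Finset.mul_sum, hg t ht]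
      ring)
    (fun t ht => by
      simp only [map_smul, inner_smul_left, inner_smul_right, inner_add_right, ← Finset.mul_sum,
        Finset.sum_add_distrib, hg t ht, hg₁ t ht]
      ring) t ht
  have hE : 0 < Real.exp (ν / 2 * t) ^ 2 := by positivity
  have hE2 : Real.exp (ν / 2 * t) ^ 2 * Real.exp (-ν * t) = 1 := by
    rw [← Real.exp_nat_mul, ← Real.exp_add, Real.exp_eq_one_iff]; push_cast; ring
  simp only [norm_smul, mul_pow, Real.norm_eq_abs, sq_abs, mul_zero, Real.exp_zero,
    ← Finset.mul_sum, one_smul] at key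
  have k1 : ‖w t + (ν / 2) • v t‖ ^ 2 + Real.exp (-2 * t) * (‖v t‖ ^ 2 + ∑ i, ‖V i t‖ ^ 2) ≤
      C * (‖v t‖ ^ 2 + Real.exp (-ν * t) *
        (‖w 0 + (ν / 2) • v 0‖ ^ 2 + ‖v 0‖ ^ 2 + ∑ i, ‖V i 0‖ ^ 2)) := by
    refine le_of_mul_le_mul_left ?_ hE
    calc _ = Real.exp (ν / 2 * t) ^ 2 * ‖w t + (ν / 2) • v t‖ ^ 2 + Real.exp (-2 * t) *
          (Real.exp (ν / 2 * t) ^ 2 * ‖v t‖ ^ 2 +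
            Real.exp (ν / 2 * t) ^ 2 * ∑ i, ‖V i t‖ ^ 2) := by ring
      _ ≤ _ := key
      _ = C * (Real.exp (ν / 2 * t) ^ 2 * ‖v t‖ ^ 2 + 1 *
        (‖w 0 + (ν / 2) • v 0‖ ^ 2 + ‖v 0‖ ^ 2 + ∑ i, ‖V i 0‖ ^ 2)) := by ring
      _ = _ := by rw [← hE2]; ring
  have hn : ∀ x y : H, ‖x + (ν / 2) • y‖ ^ 2 ≤ 2 * ‖x‖ ^ 2 + ν ^ 2 / 2 * ‖y‖ ^ 2 := by
    intro x y
    have h1 := parallelogram_law_with_norm ℝ x ((ν / 2) • y)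
    have h2 : ‖(ν / 2) • y‖ ^ 2 = ν ^ 2 / 4 * ‖y‖ ^ 2 := by
      rw [norm_smul, mul_pow, Real.norm_eq_abs, sq_abs]; ring
    nlinarith [sq_nonneg ‖x - (ν / 2) • y‖]
  have k2 := hn (w 0) (v 0)
  -- The energy bounds w + (ν/2)v; subtracting (ν/2)v recovers w at the cost of ν²‖v‖².
  have k3 := hn (w t + (ν / 2) • v t) (-v t)
  rw [smul_neg, add_neg_cancel_right, norm_neg] at k3
  have hS : 0 ≤ ∑ i, ‖V i 0‖ ^ 2 := by positivity
  have hp1 : 0 ≤ ν ^ 2 * ‖w 0‖ ^ 2 := by positivity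
  have hp2 : 0 ≤ ν ^ 2 * ‖v 0‖ ^ 2 := by positivity
  have hp3 : 0 ≤ ν ^ 2 * ∑ i, ‖V i 0‖ ^ 2 := by positivity
  have hp4 : 0 ≤ ν ^ 2 * ‖v t‖ ^ 2 := by positivity
  set e := Real.exp (-ν * t)
  have he : 0 < e := Real.exp_pos _
  set D := ‖w 0‖ ^ 2 + ‖v 0‖ ^ 2 + ∑ i, ‖V i 0‖ ^ 2 with hD
  have hD0 : 0 ≤ D := by positivity
  have k4 : ‖w 0 + (ν / 2) • v 0‖ ^ 2 + ‖v 0‖ ^ 2 + ∑ i, ‖V i 0‖ ^ 2 ≤ (ν ^ 2 + 2) * D := by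
    rw [hD]
    linarith [sq_nonneg ‖v 0‖]
  have k5 : C * (‖v t‖ ^ 2 + e * (‖w 0 + (ν / 2) • v 0‖ ^ 2 + ‖v 0‖ ^ 2 + ∑ i, ‖V i 0‖ ^ 2)) ≤
      C * (ν ^ 2 + 2) * (‖v t‖ ^ 2 + e * D) := by
    rw [mul_assoc]
    refine mul_le_mul_of_nonneg_left ?_ hC.le
    have := mul_le_mul_of_nonneg_left k4 he.le
    nlinarith [sq_nonneg ‖v t‖]
  have hp5 : 0 ≤ ν ^ 2 * (e * D) := by positivity
  have hp6 : 0 ≤ Real.exp (-2 * t) * (‖v t‖ ^ 2 + ∑ i, ‖V i t‖ ^ 2) := by positivity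
  linarith

/-! ### Real inner products in `L²` -/

theorem L2_real_inner_eq_re {n : ℕ} (f g : L2 n) : inner ℝ f g = (inner ℂ f g).re := by
  rw [L2.inner_def, L2.inner_def]
  have := integral_re (L2.integrable_inner (𝕜 := ℂ) f g)
  simp only [RCLike.re_to_complex] at this
  rw [← this]
  rfl

theorem L2_real_inner_fourier {n : ℕ} (f g : L2 n) :
    inner ℝ (𝓕 f : L2 n) (𝓕 g : L2 n) = inner ℝ f g := by
  rw [L2_real_inner_eq_re, L2_real_inner_eq_re, Lp.inner_fourier_eq]

/-- The symbol of ∂_i is unbounded, so the equation is first multiplied by Λ⁻¹. Both sides then are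
bounded multipliers on L², and the nowhere vanishing symbol of Λ⁻¹ is cancelled pointwise. -/
theorem fourier_ae_eq_of_dOp {n : ℕ} (i : Fin n) {f g : L2 n}
    (h : dOp i (toDist n f) = toDist n g) :
    ((𝓕 g : L2 n) : Space n → ℂ) =ᵐ[volume]
      fun x => 2 * Real.pi * Complex.I * (x i : ℂ) * (𝓕 f : L2 n) x := by
  have hb : ∀ x : Space n, ‖besselSymbol n (-1) x‖ ≤ 1 := fun x => by
    rw [norm_besselSymbol]
    exact Real.rpow_le_one_of_one_le_of_nonpos (by nlinarith [sq_nonneg ‖x‖]) (by norm_num)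
  obtain ⟨L, -, hL, hLf⟩ := exists_fourierL2 (besselSymbol_hasTemperateGrowth n (-1)) hb
  have hd : ∀ x : Space n, ‖(besselSymbol n (-1) *
      fun x : Space n => 2 * Real.pi * Complex.I * (x i : ℂ)) x‖ ≤ 2 * Real.pi := fun x => by
    have h1 : ‖(2 * Real.pi * Complex.I * (x i : ℂ))‖ = 2 * Real.pi * |x i| := by
      simp [abs_of_pos Real.pi_pos]
    rw [Pi.mul_apply, norm_mul, norm_besselSymbol, h1]
    calc _ ≤ (1 + ‖x‖ ^ 2) ^ ((-1 : ℝ) / 2) *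
          (2 * Real.pi * (1 + ‖x‖ ^ 2) ^ (1 / 2 : ℝ)) := by gcongr; exact abs_coord_le x i
      _ = 2 * Real.pi * ((1 + ‖x‖ ^ 2) ^ ((-1 : ℝ) / 2) * (1 + ‖x‖ ^ 2) ^ (1 / 2 : ℝ)) := by ring
      _ = 2 * Real.pi := by
        rw [← Real.rpow_add (by positivity)]
        norm_num
  have hdt := (besselSymbol_hasTemperateGrowth n (-1)).mul (dSymbol_hasTemperateGrowth i)
  obtain ⟨T, -, hT, hTf⟩ := exists_fourierL2 hdt hd
  have e : L g = T f := by
    apply toDist_injective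
    rw [← hL, ← h, ← hT, ← fourierOp_mul (by fun_prop) (by fun_prop), ← dOp_eq]
    rfl
  have h1 := hLf g
  rw [e] at h1
  filter_upwards [h1, hTf f] with x h2 h3
  rw [h3] at h2
  have h4 : besselSymbol n (-1) x ≠ 0 := by
    rw [← norm_ne_zero_iff, norm_besselSymbol]
    positivity
  simp only [Pi.mul_apply] at h2
  exact mul_left_cancel₀ h4 (by rw [← h2]; ring)

/-- Integration by parts in `H_(1)`. -/
theorem L2_inner_dOp {n : ℕ} (i : Fin n) {f f' g g' : L2 n}
    (hf : dOp i (toDist n f) = toDist n f') (hg : dOp i (toDist n g) = toDist n g') :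
    inner ℝ f' g = -inner ℝ f g' := by
  rw [← L2_real_inner_fourier f' g, ← L2_real_inner_fourier f g', L2.inner_def, L2.inner_def,
    ← integral_neg]
  refine integral_congr_ae ?_
  filter_upwards [fourier_ae_eq_of_dOp i hf, fourier_ae_eq_of_dOp i hg] with x h1 h2
  rw [h1, h2]
  simp only [Complex.inner]
  simp
  ring

theorem L2_inner_mul {n : ℕ} {a : Space n → ℝ} {f f' g g' : L2 n}
    (hf : (f' : Space n → ℂ) =ᵐ[volume] fun x => (a x : ℂ) * f x)
    (hg : (g' : Space n → ℂ) =ᵐ[volume] fun x => (a x : ℂ) * g x) :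
    inner ℝ f' g = inner ℝ f g' := by
  rw [L2.inner_def, L2.inner_def]
  refine integral_congr_ae ?_
  filter_upwards [hf, hg] with x h1 h2
  rw [h1, h2]
  simp only [Complex.inner]
  simp
  ring

/-- Pointwise ellipticity is applied separately to the real and imaginary parts of X, which decouple
because the coefficients are real, and then integrated. -/
theorem SecondOrderOp.coercive {n : ℕ} {A : SecondOrderOp n} {δ : ℝ}
    (hδ : ∀ x ξ : Space n, -(∑ i, ∑ j, A.a i j x * ξ i * ξ j) ≤ -(δ * ‖ξ‖ ^ 2))
    (X : Fin n → L2 n) (Y : Fin n → Fin n → L2 n)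
    (hY : ∀ i j, (Y i j : Space n → ℂ) =ᵐ[volume] fun x => (A.symm i j x : ℂ) * X j x) :
    δ * ∑ i, ‖X i‖ ^ 2 ≤ ∑ i, ∑ j, inner ℝ (Y i j) (X i) := by
  have h1 : ∑ i, ∑ j, inner ℝ (Y i j) (X i) =
      ∫ x, ∑ i, ∑ j, inner ℝ (Y i j x) (X i x) := by
    rw [integral_finsetSum _ fun i _ => integrable_finsetSum _ fun j _ => L2.integrable_inner _ _]
    refine Finset.sum_congr rfl fun i _ => ?_
    rw [integral_finsetSum _ fun j _ => L2.integrable_inner _ _]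
    exact Finset.sum_congr rfl fun j _ => L2.inner_def _ _
  have h2 : δ * ∑ i, ‖X i‖ ^ 2 = ∫ x, δ * ∑ i, inner ℝ (X i x) (X i x) := by
    rw [integral_const_mul, integral_finsetSum _ fun i _ => L2.integrable_inner _ _]
    congr 1
    refine Finset.sum_congr rfl fun i _ => ?_
    rw [← real_inner_self_eq_norm_sq, L2.inner_def]
  rw [h1, h2]
  refine integral_mono_ae ((integrable_finsetSum _ fun i _ =>
    L2.integrable_inner _ _).const_mul δ)
    (integrable_finsetSum _ fun i _ => integrable_finsetSum _ fun j _ =>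
      L2.integrable_inner _ _) ?_
  have hY' : ∀ᵐ x, ∀ i j, Y i j x = (A.symm i j x : ℂ) * X j x :=
    ae_all_iff.2 fun i => ae_all_iff.2 fun j => hY i j
  filter_upwards [hY'] with x hx
  have key : ∀ ξ : Fin n → ℝ, δ * ∑ i, ξ i ^ 2 ≤ ∑ i, ∑ j, A.symm i j x * ξ i * ξ j := by
    intro ξ
    have h := hδ x (WithLp.toLp 2 ξ)
    rw [EuclideanSpace.norm_sq_eq] at h
    simp only [Real.norm_eq_abs, sq_abs] at h
    rw [A.sum_symm]
    linarith
  have k1 := key fun i => (X i x).re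
  have k2 := key fun i => (X i x).im
  have e1 : δ * ∑ i, inner ℝ (X i x) (X i x) =
      δ * ∑ i, (X i x).re ^ 2 + δ * ∑ i, (X i x).im ^ 2 := by
    rw [← mul_add, ← Finset.sum_add_distrib]
    congr 1
    refine Finset.sum_congr rfl fun i _ => ?_
    rw [real_inner_self_eq_norm_sq, ← Complex.normSq_eq_norm_sq, Complex.normSq_apply]
    ring
  have e2 : ∑ i, ∑ j, inner ℝ (Y i j x) (X i x) =
      (∑ i, ∑ j, A.symm i j x * (X i x).re * (X j x).re) +
        ∑ i, ∑ j, A.symm i j x * (X i x).im * (X j x).im := by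
    rw [← Finset.sum_add_distrib]
    refine Finset.sum_congr rfl fun i _ => ?_
    rw [← Finset.sum_add_distrib]
    refine Finset.sum_congr rfl fun j _ => ?_
    rw [hx i j]
    simp
    ring
  rw [e1, e2]
  linarith

end DeSitterKG
end

/-! ### The energy estimate for localized solutions, uniform in the frequency parameter. -/

noncomputable section

namespace DeSitterKG

open MeasureTheory Filter Topology Set TemperedDistribution FourierTransform

/-! ### The energy estimate for the frequency localized equation -/

theorem sobolevRep_iff {n : ℕ} {s : ℝ} {u : Dist n} {f : L2 n} :
    SobolevRep s u f ↔ bessel n s u = toDist n f := Iff.rfl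

theorem sobolevRep_zero_iff {n : ℕ} {u : Dist n} {f : L2 n} :
    SobolevRep 0 u f ↔ u = toDist n f := by
  rw [sobolevRep_iff, bessel_zero]; rfl

theorem SobolevRep.eq_bessel {n : ℕ} {s : ℝ} {u : Dist n} {f : L2 n} (h : SobolevRep s u f) :
    u = bessel n (-s) (toDist n f) := by
  rw [← sobolevRep_iff.1 h]; simp

/-- The H_(1) norm is controlled by v and its first derivatives: Λ = Λ⁻¹Λ² = Λ⁻¹ − κ∑Λ⁻¹∂_i∂_i, and
Λ⁻¹, Λ⁻¹∂_i are bounded on L². -/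
theorem exists_norm_rep_one_le (n : ℕ) : ∃ C, 0 ≤ C ∧ ∀ (v r : L2 n) (V : Fin n → L2 n),
    SobolevRep 1 (toDist n v) r → (∀ i, dOp i (toDist n v) = toDist n (V i)) →
      ‖r‖ ≤ C * (‖v‖ + ∑ i, ‖V i‖) := by
  obtain ⟨L, hL, hLr⟩ := (bddOp_bessel (n := n) (r := 0) (q := 0) (s := -1)
    (by norm_num)).exists_rep
  have hd : ∀ i : Fin n, BddOp 0 0 (bessel n (-1) * dOp i) (1 * (2 * Real.pi)) := fun i =>
    (bddOp_bessel (by norm_num)).mul (bddOp_dOp i 0)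
  choose D hD hDr using fun i => (hd i).exists_rep
  obtain ⟨κ, hκ⟩ : ∃ κ : ℂ, κ = (((2 * Real.pi) ^ 2)⁻¹ : ℂ) := ⟨_, rfl⟩
  have hb2 := bessel_two n
  rw [← hκ] at hb2
  refine ⟨1 + ‖κ‖ * (1 * (2 * Real.pi)), by positivity, fun v r V hr hV => ?_⟩
  have key : r = L v - κ • ∑ i, D i (V i) := by
    apply toDist_injective
    rw [← sobolevRep_iff.1 hr, map_sub, map_smul, map_sum]
    have h1 := sobolevRep_zero_iff.1 (hLr (toDist n v) v (sobolevRep_zero_iff.2 rfl))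
    have h2 := fun i => sobolevRep_zero_iff.1
      (hDr i (toDist n (V i)) (V i) (sobolevRep_zero_iff.2 rfl))
    simp only [← h1, ← h2, ← hV]
    have h3 : bessel n 1 = bessel n (-1) - κ • ∑ i : Fin n, (bessel n (-1) * dOp i) * dOp i := by
      calc bessel n 1 = bessel n (-1) * bessel n 2 := by rw [bessel_mul_bessel]; norm_num
        _ = _ := by
          rw [hb2, mul_sub, mul_one, mul_smul_comm, Finset.mul_sum]
          simp only [mul_assoc]
    rw [h3]
    simp only [_root_.sub_apply, _root_.smul_apply, _root_.sum_apply]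
    rfl
  have hS : ‖∑ i, D i (V i)‖ ≤ 1 * (2 * Real.pi) * ∑ i, ‖V i‖ := by
    rw [Finset.mul_sum]
    exact norm_sum_le_of_le _ fun i _ => (D i).le_of_opNorm_le (hD i) _
  rw [key]
  refine (norm_sub_le _ _).trans ?_
  rw [norm_smul]
  have h1 : ‖L v‖ ≤ 1 * ‖v‖ := L.le_of_opNorm_le hL v
  have h2 := mul_le_mul_of_nonneg_left hS (norm_nonneg κ)
  have h3 : 0 ≤ ‖κ‖ * (1 * (2 * Real.pi)) * ‖v‖ := by positivity
  have h4 : 0 ≤ ∑ i, ‖V i‖ := by positivity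
  linarith

/-- Splits A + B into the divergence form part, integrated by parts, and the first order remainder
b. The H_(2) regularity of v places each ∂_i(a_ij ∂_j v) in L²; the test function x needs only one
derivative, so it may be the time derivative of the solution. -/
theorem SecondOrderOp.HasBInftyCoeffs.inner_op_add {n : ℕ} {A : SecondOrderOp n}
    (hA : A.HasBInftyCoeffs) {M : Fin n → Fin n → L2 n →L[ℂ] L2 n}
    (hM : ∀ i j f, mulOp (fun x => (A.symm i j x : ℂ)) (toDist n f) = toDist n (M i j f))
    {B : DistOp n} {v f₂ g b : L2 n} {V : Fin n → L2 n} (hf₂ : SobolevRep 2 (toDist n v) f₂)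
    (hV : ∀ i, dOp i (toDist n v) = toDist n (V i)) (hg : (A.op + B) (toDist n v) = toDist n g)
    (hb : (A.op - A.divOp + B) (toDist n v) = toDist n b) {x : L2 n} {X : Fin n → L2 n}
    (hX : ∀ i, dOp i (toDist n x) = toDist n (X i)) :
    inner ℝ g x = -(∑ i, ∑ j, inner ℝ (M i j (V j)) (X i)) + inner ℝ b x := by
  have hZ : ∀ i j, ∃ Z : L2 n, dOp i (toDist n (M i j (V j))) = toDist n Z := by
    intro i j
    have h1 : HasOrder 2 (dOp i * (mulOp (fun x => (A.symm i j x : ℂ)) * dOp j)) :=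
      (hasOrder_dOp i).mul ((hA.symm i j).ofReal.hasOrder_mulOp.mul (hasOrder_dOp j) rfl) rfl
    obtain ⟨C, hC⟩ := h1 2
    norm_num at hC
    obtain ⟨L, -, hL⟩ := hC.exists_rep
    refine ⟨L f₂, ?_⟩
    rw [← hM, ← hV]
    exact sobolevRep_zero_iff.1 (hL _ _ hf₂)
  choose Z hZ using hZ
  have e : g = (∑ i, ∑ j, Z i j) + b := by
    apply toDist_injective
    rw [map_add, map_sum, ← hg, ← hb]
    simp only [map_sum, ← hZ, ← hM, ← hV]
    have : A.op + B = A.divOp + (A.op - A.divOp + B) := by abel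
    rw [this, _root_.add_apply A.divOp, SecondOrderOp.divOp]
    simp only [_root_.sum_apply]
    rfl
  rw [e, inner_add_left, sum_inner, ← Finset.sum_neg_distrib]
  congr 1
  refine Finset.sum_congr rfl fun i _ => ?_
  rw [sum_inner, ← Finset.sum_neg_distrib]
  exact Finset.sum_congr rfl fun j _ => L2_inner_dOp i (hZ i j) (hX i)

theorem bddOp_freqOp {n : ℕ} {k : ℤ} {l : ℝ} (hl : 0 ≤ l) {r q : ℝ} (h : q ≤ r - 2 * k + 4) :
    BddOp r q (freqOp n k l) 1 := by
  have := (bddOp_resolventOp n hl (r := r - 2 * k + 2) (q := q) (by linarith)).mul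
    ((bddOp_resolventOp n hl (r := r - 2 * k) (by linarith)).mul
      (bddOp_bessel (n := n) (r := r) (s := (2 * k : ℤ)) (by push_cast; linarith)))
  simpa [freqOp] using this

/-- The symbol of the frequency localization. -/
def freqSymbol (n : ℕ) (k : ℤ) (l : ℝ) : Space n → ℂ :=
  resolventSymbol n l * (resolventSymbol n l * besselSymbol n (2 * k : ℤ))

theorem freqSymbol_hasTemperateGrowth (n : ℕ) (k : ℤ) {l : ℝ} (hl : 0 ≤ l) :
    (freqSymbol n k l).HasTemperateGrowth :=
  (resolventSymbol_hasTemperateGrowth n hl).mul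
    ((resolventSymbol_hasTemperateGrowth n hl).mul (besselSymbol_hasTemperateGrowth n _))

theorem freqOp_eq (n : ℕ) (k : ℤ) {l : ℝ} (hl : 0 ≤ l) :
    freqOp n k l = fourierOp (freqSymbol n k l) := by
  have h := resolventSymbol_hasTemperateGrowth n hl
  rw [freqOp, freqSymbol, bessel_eq, resolventOp, fourierOp_mul h (by fun_prop),
    fourierOp_mul h (h.mul (by fun_prop))]

theorem bessel_mul_freqOp (n : ℕ) (k : ℤ) {l : ℝ} (hl : 0 ≤ l) (s : ℝ) :
    bessel n s * freqOp n k l = freqOp n k l * bessel n s := by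
  have h := freqSymbol_hasTemperateGrowth n k hl
  rw [freqOp_eq n k hl, bessel_eq, fourierOp_mul (by fun_prop) h, fourierOp_mul h (by fun_prop),
    mul_comm]

theorem hasDerivWithinAt_clm_comp {n : ℕ} (L : L2 n →L[ℂ] L2 n) {f : ℝ → L2 n} {f' : L2 n}
    {s : Set ℝ} {t : ℝ} (h : HasDerivWithinAt f f' s t) :
    HasDerivWithinAt (fun t => L (f t)) (L f') s t :=
  (L.restrictScalars ℝ).hasFDerivAt.comp_hasDerivWithinAt t h

theorem IsEnergySolution.freqOp_equation {n : ℕ} {A : SecondOrderOp n} {m2 s : ℝ}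
    {ψ₀ ψ₁ : Dist n} {ψ ψt ψtt : ℝ → Dist n} (h : IsEnergySolution A m2 s ψ₀ ψ₁ ψ ψt ψtt)
    {P S : DistOp n} (hP : P * A.op = S * P) {t : ℝ} (ht : 0 ≤ t) {v w z : L2 n}
    (hv : P (ψ t) = toDist n v) (hw : P (ψt t) = toDist n w) (hz : P (ψtt t) = toDist n z) :
    S (toDist n v) = toDist n (Real.exp (2 * t) • (z + (n : ℝ) • w + m2 • v)) := by
  have h1 := congrArg P (h.equation t ht)
  rw [map_zero, map_add, map_sub, map_add, map_smul, map_smul, map_smul, hv, hw, hz,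
    ← A.op_apply] at h1
  have h2 : P (A.op (ψ t)) = S (toDist n v) := by
    rw [← hv]
    exact congrArg (fun Q : DistOp n => Q (ψ t)) hP
  rw [h2] at h1
  have h3 : (Real.exp (2 * t) : ℂ) * (Real.exp (-2 * t) : ℂ) = 1 := by
    rw [← Complex.ofReal_mul, ← Real.exp_add]
    simp
  have h4 : ∀ (r : ℝ) (f : L2 n), toDist n (r • f) = (r : ℂ) • toDist n f := fun r f => by
    rw [← map_smul]
    congr 1
  rw [h4, map_add, map_add, h4, h4]
  have h5 : (Real.exp (-2 * t) : ℂ) • S (toDist n v) =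
      toDist n z + ((n : ℝ) : ℂ) • toDist n w + (m2 : ℂ) • toDist n v := by
    rw [Complex.ofReal_natCast]
    rw [← sub_eq_zero, ← neg_eq_zero, ← h1]
    abel
  rw [← h5, smul_smul, h3, one_smul]

/-- The localization gains 4 − 2k derivatives, so −3 ≤ s − 2k is what puts P_lψ in H_(2), P_lψ_t in
H_(1) and P_lψ_tt in L². These memberships are used only qualitatively; the constants come from
operators whose bounds do not involve l. -/
theorem exists_freq_energy_bound {n : ℕ} {A : SecondOrderOp n} (hA : A.HasBInftyCoeffs)
    (hell : A.IsNegativeElliptic) (m2 s : ℝ) (k : ℤ) (hk : -3 ≤ s - 2 * k) :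
    ∃ C, 0 < C ∧ ∀ (l : ℝ) (T : L2 n →L[ℂ] L2 n), 0 ≤ l →
      (∀ f, freqOp n k l (bessel n (-s) (toDist n f)) = toDist n (T f)) →
      ∀ (ψ₀ ψ₁ : Dist n) (ψ ψt ψtt : ℝ → Dist n) (φ φ₁ χ : ℝ → L2 n),
        IsEnergySolution A m2 s ψ₀ ψ₁ ψ ψt ψtt →
        (∀ t, 0 ≤ t → SobolevRep s (ψ t) (φ t)) →
        (∀ t, 0 ≤ t → SobolevRep (s + 1) (ψ t) (φ₁ t)) →
        (∀ t, 0 ≤ t → SobolevRep s (ψt t) (χ t)) →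
        ∀ t, 0 ≤ t → ‖T (χ t)‖ ^ 2 + Real.exp (-2 * t) * ‖T (φ₁ t)‖ ^ 2 ≤
          C * (‖T (φ t)‖ ^ 2 +
            Real.exp (-(n : ℝ) * t) * (‖T (χ 0)‖ ^ 2 + ‖T (φ₁ 0)‖ ^ 2)) := by
  obtain ⟨δ, hδ, hell⟩ := hell
  have hMex : ∀ i j, ∃ M : L2 n →L[ℂ] L2 n,
      (∀ f, mulOp (fun x => (A.symm i j x : ℂ)) (toDist n f) = toDist n (M f)) ∧
        ∀ f, (M f : Space n → ℂ) =ᵐ[volume] fun x => (A.symm i j x : ℂ) * f x := by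
    intro i j
    obtain ⟨C, hC⟩ := (hA.symm i j).ofReal.exists_bound
    obtain ⟨L, -, h1, h2⟩ := exists_mulL2 (hA.symm i j).ofReal.hasTemperateGrowth hC
    exact ⟨L, h1, h2⟩
  choose M hMd hMae using hMex
  obtain ⟨C1, hC1⟩ := hA.isDiffLike_op.exists_freqOp_mul k
  obtain ⟨C2, hC2⟩ := hA.hasOrder_op_sub_divOp 1
  norm_num at hC2
  obtain ⟨C3, hC3, hrep⟩ := exists_norm_rep_one_le n
  have hC12 : 0 ≤ C2 + C1 := by
    obtain ⟨B, hB, -⟩ := hC1 0 le_rfl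
    exact add_nonneg hC2.nonneg hB.nonneg
  obtain ⟨C, hC, hE⟩ := exists_damped_energy_bound
    (fun i j => (M i j).restrictScalars ℝ)
    (fun i j x y => L2_inner_mul (a := A.symm i j) (hMae i j x)
      (by rw [A.symm_comm i j]; exact hMae j i y)) hδ
    (fun X => A.coercive hell X (fun i j => M i j (X j)) fun i j => hMae i j (X j))
    (K := (C2 + C1) * C3) (by positivity) n m2
  obtain ⟨N0, hN0⟩ : ∃ N0 : ℝ, N0 = 1 + (1 + Fintype.card (Fin n)) * C3 ^ 2 := ⟨_, rfl⟩
  have hN01 : 1 ≤ N0 := by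
    rw [hN0]
    have : 0 ≤ (1 + (Fintype.card (Fin n) : ℝ)) * C3 ^ 2 := by positivity
    linarith
  obtain ⟨D0, hD0⟩ : ∃ D0 : ℝ, D0 = 1 + n * (2 * Real.pi) ^ 2 := ⟨_, rfl⟩
  have hD01 : 1 ≤ D0 := by
    rw [hD0]
    have : 0 ≤ (n : ℝ) * (2 * Real.pi) ^ 2 := by positivity
    linarith
  refine ⟨N0 * C * D0, by positivity, ?_⟩
  intro l T hl hT ψ₀ ψ₁ ψ ψt ψtt φ φ₁ χ hψ hφ hφ₁ hχ t ht
  obtain ⟨B, hB, hPB⟩ := hC1 l hl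
  obtain ⟨Lb, hLb, hLbr⟩ := (hC2.add hB).exists_rep
  have hTs : ∀ {u f}, SobolevRep s u f → freqOp n k l u = toDist n (T f) := by
    intro u f hu
    rw [hu.eq_bessel]
    exact hT f
  have hT1 : ∀ {u f}, SobolevRep (s + 1) u f → SobolevRep 1 (freqOp n k l u) (T f) := by
    intro u f hu
    rw [sobolevRep_iff, ← hT, hu.eq_bessel]
    change (bessel n 1 * freqOp n k l * bessel n (-(s + 1))) (toDist n f) =
      (freqOp n k l * bessel n (-s)) (toDist n f)
    rw [bessel_mul_freqOp n k hl, mul_assoc, bessel_mul_bessel]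
    congr 3
    ring
  obtain ⟨T', -, hT'⟩ := (bddOp_freqOp (n := n) (k := k) hl (r := s - 1) (q := 0)
    (by linarith)).exists_rep
  obtain ⟨T₂, -, hT₂⟩ := (bddOp_freqOp (n := n) (k := k) hl (r := s + 1) (q := 2)
    (by linarith)).exists_rep
  have hdP : ∀ i : Fin n, BddOp s 0 (dOp i * freqOp n k l) (2 * Real.pi * 1) := fun i =>
    BddOp.mul (by simpa using bddOp_dOp i 1) (bddOp_freqOp hl (by linarith))
  choose Td hTdn hTd using fun i => (hdP i).exists_rep
  obtain ⟨f, f', hf, hf', hff'⟩ := hψ.hasDeriv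
  obtain ⟨h, h', hh, hh', hhh'⟩ := hψ.hasDeriv_deriv
  have eφ : ∀ t, 0 ≤ t → f t = φ t := fun t ht => (hf t ht).unique (hφ t ht)
  have eχ : ∀ t, 0 ≤ t → f' t = χ t := fun t ht => (hf' t ht).unique (hχ t ht)
  -- ψ_t is differentiable only in H_(s-1); expressing P_lψ_t through its representative there makes
  -- it differentiable in L².
  have ew : ∀ t, 0 ≤ t → T (f' t) = T' (h t) := fun t ht => by
    apply toDist_injective
    rw [← hTs (hf' t ht), sobolevRep_zero_iff.1 (hT' _ _ (hh t ht))]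
  have hv : ∀ t, 0 ≤ t → freqOp n k l (ψ t) = toDist n (T (f t)) := fun t ht => hTs (hf t ht)
  have hw : ∀ t, 0 ≤ t → freqOp n k l (ψt t) = toDist n (T (f' t)) := fun t ht => hTs (hf' t ht)
  have hz : ∀ t, 0 ≤ t → freqOp n k l (ψtt t) = toDist n (T' (h' t)) := fun t ht =>
    sobolevRep_zero_iff.1 (hT' _ _ (hh' t ht))
  have hV : ∀ t, 0 ≤ t → ∀ i, dOp i (toDist n (T (f t))) = toDist n (Td i (f t)) :=
    fun t ht i => by
      rw [← hv t ht]; exact sobolevRep_zero_iff.1 (hTd i _ _ (hf t ht))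
  have hW : ∀ t, 0 ≤ t → ∀ i, dOp i (toDist n (T (f' t))) = toDist n (Td i (f' t)) :=
    fun t ht i => by
      rw [← hw t ht]; exact sobolevRep_zero_iff.1 (hTd i _ _ (hf' t ht))
  have hr1 : ∀ t, 0 ≤ t → SobolevRep 1 (toDist n (T (f t))) (T (φ₁ t)) := fun t ht => by
    rw [← hv t ht]; exact hT1 (hφ₁ t ht)
  have hr2 : ∀ t, 0 ≤ t → SobolevRep 2 (toDist n (T (f t))) (T₂ (φ₁ t)) := fun t ht => by
    rw [← hv t ht]; exact hT₂ _ _ (hφ₁ t ht)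
  have hb : ∀ t, 0 ≤ t → (A.op - A.divOp + B) (toDist n (T (f t))) =
      toDist n (Lb (T (φ₁ t))) := fun t ht =>
    sobolevRep_zero_iff.1 (hLbr _ _ (hr1 t ht))
  have hg : ∀ t, 0 ≤ t → (A.op + B) (toDist n (T (f t))) = toDist n (Real.exp (2 * t) •
      (T' (h' t) + (n : ℝ) • T (f' t) + m2 • T (f t))) := fun t ht =>
    hψ.freqOp_equation hPB ht (hv t ht) (hw t ht) (hz t ht)
  have key := hE (fun t => T (f t)) (fun t => T (f' t)) (fun t => T' (h' t))
    -- The spatial term g is read off from the equation, so that it is visibly an element of L².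
    (fun t => Real.exp (2 * t) • (T' (h' t) + (n : ℝ) • T (f' t) + m2 • T (f t)))
    (fun t => Lb (T (φ₁ t))) (fun i t => Td i (f t)) (fun i t => Td i (f' t))
    (fun t ht => hasDerivWithinAt_clm_comp T (hff' t ht))
    (fun t ht => (hasDerivWithinAt_clm_comp T' (hhh' t ht)).congr
      (fun x hx => ew x hx) (ew t ht))
    (fun i t ht => hasDerivWithinAt_clm_comp (Td i) (hff' t ht))
    (fun t ht => by
      rw [smul_smul, ← Real.exp_add, neg_mul, neg_add_cancel, Real.exp_zero, one_smul])
    (fun t ht => by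
      calc ‖Lb (T (φ₁ t))‖ ≤ (C2 + C1) * ‖T (φ₁ t)‖ := Lb.le_of_opNorm_le hLb _
        _ ≤ (C2 + C1) * (C3 * (‖T (f t)‖ + ∑ i, ‖Td i (f t)‖)) := by
          gcongr
          exact hrep _ _ _ (hr1 t ht) (hV t ht)
        _ = _ := by ring)
    (fun t ht => hA.inner_op_add hMd (hr2 t ht) (hV t ht) (hg t ht) (hb t ht) (hV t ht))
    (fun t ht => hA.inner_op_add hMd (hr2 t ht) (hV t ht) (hg t ht) (hb t ht) (hW t ht))
    t ht
  have k1 : ‖T (φ₁ t)‖ ^ 2 ≤ N0 * (‖T (f t)‖ ^ 2 + ∑ i, ‖Td i (f t)‖ ^ 2) := by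
    have h1 := hrep _ _ _ (hr1 t ht) (hV t ht)
    have h2 := sq_add_sum_le ‖T (f t)‖ fun i => ‖Td i (f t)‖
    have h3 : 0 ≤ ‖T (f t)‖ ^ 2 + ∑ i, ‖Td i (f t)‖ ^ 2 := by positivity
    calc _ ≤ (C3 * (‖T (f t)‖ + ∑ i, ‖Td i (f t)‖)) ^ 2 := by gcongr
      _ = C3 ^ 2 * (‖T (f t)‖ + ∑ i, ‖Td i (f t)‖) ^ 2 := by ring
      _ ≤ C3 ^ 2 * ((1 + Fintype.card (Fin n)) *
          (‖T (f t)‖ ^ 2 + ∑ i, ‖Td i (f t)‖ ^ 2)) := by gcongr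
      _ ≤ _ := by rw [hN0]; nlinarith
  have k2 : ‖T (f 0)‖ ^ 2 + ∑ i, ‖Td i (f 0)‖ ^ 2 ≤ D0 * ‖T (φ₁ 0)‖ ^ 2 := by
    have h0 := hr1 0 le_rfl
    obtain ⟨I, hI, hIr⟩ := (bddOp_one (n := n) (r := 1) (q := 0) (by norm_num)).exists_rep
    have e1 : T (f 0) = I (T (φ₁ 0)) := toDist_injective n (sobolevRep_zero_iff.1 (hIr _ _ h0))
    have e2 : ‖T (f 0)‖ ≤ ‖T (φ₁ 0)‖ := by
      rw [e1]; simpa using I.le_of_opNorm_le hI (T (φ₁ 0))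
    have e3 : ∀ i, ‖Td i (f 0)‖ ≤ 2 * Real.pi * ‖T (φ₁ 0)‖ := by
      intro i
      obtain ⟨J, hJ, hJr⟩ := (bddOp_dOp i 1).exists_rep
      rw [sub_self] at hJr
      have e4 : Td i (f 0) = J (T (φ₁ 0)) := by
        apply toDist_injective
        rw [← hV 0 le_rfl i]
        exact sobolevRep_zero_iff.1 (hJr _ _ h0)
      rw [e4]
      exact J.le_of_opNorm_le hJ _
    calc _ ≤ ‖T (φ₁ 0)‖ ^ 2 + ∑ i : Fin n, (2 * Real.pi * ‖T (φ₁ 0)‖) ^ 2 := by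
          gcongr with i
          exact e3 i
      _ = _ := by
          rw [hD0, Finset.sum_const, Finset.card_univ, Fintype.card_fin, nsmul_eq_mul]; ring
  simp only [eφ t ht, eχ t ht, eχ 0 le_rfl] at key k1 k2
  have hexp := Real.exp_pos (-2 * t)
  have hexpn := Real.exp_pos (-(n : ℝ) * t)
  calc ‖T (χ t)‖ ^ 2 + Real.exp (-2 * t) * ‖T (φ₁ t)‖ ^ 2
      ≤ N0 * ‖T (χ t)‖ ^ 2 + Real.exp (-2 * t) *
        (N0 * (‖T (φ t)‖ ^ 2 + ∑ i, ‖Td i (φ t)‖ ^ 2)) := by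
        gcongr
        exact le_mul_of_one_le_left (by positivity) hN01
    _ = N0 * (‖T (χ t)‖ ^ 2 + Real.exp (-2 * t) *
        (‖T (φ t)‖ ^ 2 + ∑ i, ‖Td i (φ t)‖ ^ 2)) := by ring
    _ ≤ N0 * (C * (‖T (φ t)‖ ^ 2 + Real.exp (-(n : ℝ) * t) *
        (‖T (χ 0)‖ ^ 2 + ‖T (f 0)‖ ^ 2 + ∑ i, ‖Td i (f 0)‖ ^ 2))) := by gcongr
    _ ≤ N0 * (C * (D0 * ‖T (φ t)‖ ^ 2 + Real.exp (-(n : ℝ) * t) *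
        (D0 * ‖T (χ 0)‖ ^ 2 + D0 * ‖T (φ₁ 0)‖ ^ 2))) := by
        rw [add_assoc (‖T (χ 0)‖ ^ 2)]
        gcongr
        · exact le_mul_of_one_le_left (by positivity) hD01
        · exact le_mul_of_one_le_left (by positivity) hD01
    _ = _ := by ring

end DeSitterKG
end

/-! ### Recovering the Sobolev norms by integrating over the frequency parameter. -/

noncomputable section

namespace DeSitterKG

open MeasureTheory Filter Topology Set TemperedDistribution FourierTransform

/-! ### Superposition over the frequency parameter -/

/-- The value of the weighted integral of the squared localization symbol. -/
def weightIntegral (p : ℝ) : ℝ := ∫ l in Ioi (0 : ℝ), l ^ p * ((l + 1) ^ 4)⁻¹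

theorem integrableOn_weight {p : ℝ} (hp0 : 0 ≤ p) (hp2 : p ≤ 2) :
    IntegrableOn (fun l : ℝ => l ^ p * ((l + 1) ^ 4)⁻¹) (Ioi 0) := by
  have h := integrableOn_add_rpow_Ioi_of_lt (a := -2) (c := 0) (m := 1) (by norm_num)
    (by norm_num)
  refine Integrable.mono' h (by fun_prop) ?_
  refine (ae_restrict_iff' measurableSet_Ioi).2 (Eventually.of_forall fun l hl => ?_)
  have hl' : (0 : ℝ) < l := hl
  rw [Real.norm_of_nonneg (by positivity), Real.rpow_neg (by positivity), Real.rpow_two]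
  have h1 : l ^ p ≤ (l + 1) ^ 2 := by
    calc l ^ p ≤ (l + 1) ^ p := Real.rpow_le_rpow hl'.le (by linarith) hp0
      _ ≤ (l + 1) ^ (2 : ℝ) := Real.rpow_le_rpow_of_exponent_le (by linarith) hp2
      _ = _ := Real.rpow_two _
  calc _ ≤ (l + 1) ^ 2 * ((l + 1) ^ 4)⁻¹ := by gcongr
    _ = _ := by field_simp

theorem weightIntegral_pos {p : ℝ} (hp0 : 0 ≤ p) (hp2 : p ≤ 2) : 0 < weightIntegral p := by
  have hpos : ∀ l ∈ Ioi (0 : ℝ), 0 < l ^ p * ((l + 1) ^ 4)⁻¹ := fun l hl => by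
    have hl' : (0 : ℝ) < l := hl
    positivity
  rw [weightIntegral, setIntegral_pos_iff_support_of_nonneg_ae
    ((ae_restrict_iff' measurableSet_Ioi).2 (Eventually.of_forall fun l hl => (hpos l hl).le))
    (integrableOn_weight hp0 hp2)]
  have h : Function.support (fun l : ℝ => l ^ p * ((l + 1) ^ 4)⁻¹) ∩ Ioi 0 = Ioi 0 :=
    inter_eq_right.2 fun l hl => (hpos l hl).ne'
  rw [h, Real.volume_Ioi]
  exact ENNReal.zero_lt_top

/-- The substitution l ↦ Xl shows that the power X^{3-p} exactly cancels the dependence on X. It is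
applied with X = 1+|ξ|². -/
theorem integral_scaled_weight {p : ℝ} (hp0 : 0 ≤ p) (hp2 : p ≤ 2) {X : ℝ} (hX : 0 < X) :
    IntegrableOn (fun l : ℝ => l ^ p * (((l + X) ^ 4)⁻¹ * X ^ (3 - p))) (Ioi 0) ∧
      ∫ l in Ioi (0 : ℝ), l ^ p * (((l + X) ^ 4)⁻¹ * X ^ (3 - p)) = weightIntegral p := by
  have h1 : ∀ l ∈ Ioi (0 : ℝ), (X * l) ^ p * (((X * l + X) ^ 4)⁻¹ * X ^ (3 - p)) =
      X⁻¹ * (l ^ p * ((l + 1) ^ 4)⁻¹) := by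
    intro l hl
    have hl' : (0 : ℝ) < l := hl
    have h2 : X ^ (3 - p) * X ^ p = X ^ 3 := by
      rw [← Real.rpow_add hX, sub_add_cancel]
      exact_mod_cast Real.rpow_natCast X 3
    rw [Real.mul_rpow hX.le hl'.le, show X * l + X = X * (l + 1) by ring, mul_pow]
    calc _ = (X ^ (3 - p) * X ^ p) * l ^ p * (X ^ 4 * (l + 1) ^ 4)⁻¹ := by ring
      _ = _ := by rw [h2]; field_simp
  constructor
  · have h2 := integrableOn_Ioi_comp_mul_left_iff
      (fun l : ℝ => l ^ p * (((l + X) ^ 4)⁻¹ * X ^ (3 - p))) 0 hX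
    rw [mul_zero] at h2
    rw [← h2, integrableOn_congr_fun h1 measurableSet_Ioi]
    exact (integrableOn_weight hp0 hp2).const_mul _
  · have h2 := integral_comp_mul_left_Ioi
      (fun l : ℝ => l ^ p * (((l + X) ^ 4)⁻¹ * X ^ (3 - p))) 0 hX
    rw [mul_zero, setIntegral_congr_fun measurableSet_Ioi h1, integral_const_mul,
      smul_eq_mul] at h2
    exact (mul_left_cancel₀ (inv_ne_zero hX.ne') h2).symm

theorem norm_sq_freqSymbol_mul (n : ℕ) (k : ℤ) (s : ℝ) {l : ℝ} (hl : 0 ≤ l) (x : Space n) :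
    ‖(freqSymbol n k l * besselSymbol n (-s)) x‖ ^ 2 =
      ((l + (1 + ‖x‖ ^ 2)) ^ 4)⁻¹ * (1 + ‖x‖ ^ 2) ^ (2 * k - s) := by
  have hX : 0 < 1 + ‖x‖ ^ 2 := by positivity
  simp only [freqSymbol, Pi.mul_apply, norm_mul, norm_resolventSymbol n hl, norm_besselSymbol]
  have h1 : (1 + ‖x‖ ^ 2) ^ (2 * k - s) =
      ((1 + ‖x‖ ^ 2) ^ (((2 * k : ℤ) : ℝ) / 2) * (1 + ‖x‖ ^ 2) ^ (-s / 2)) ^ 2 := by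
    rw [← Real.rpow_add hX, ← Real.rpow_mul_natCast hX.le]
    congr 1
    push_cast
    ring
  rw [h1]
  field_simp

theorem L2_norm_sq_eq_integral {n : ℕ} (f : L2 n) : ‖f‖ ^ 2 = ∫ x, ‖f x‖ ^ 2 := by
  rw [← real_inner_self_eq_norm_sq, L2.inner_def]
  simp only [real_inner_self_eq_norm_sq]

theorem integrable_L2_norm_sq {n : ℕ} (f : L2 n) : Integrable (fun x => ‖f x‖ ^ 2) := by
  have := L2.integrable_inner (𝕜 := ℝ) f f
  simpa only [real_inner_self_eq_norm_sq] using this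

/-- The squared `L²` norm is a superposition of squared norms of frequency localizations. -/
theorem integral_norm_sq_freq {n : ℕ} {k : ℤ} {s : ℝ} (hk0 : -3 ≤ s - 2 * k)
    (hk1 : s - 2 * k ≤ -1) {T : ℝ → L2 n →L[ℂ] L2 n}
    (hT : ∀ l, 0 ≤ l → ∀ f, ((𝓕 (T l f) : L2 n) : Space n → ℂ) =ᵐ[volume]
      fun x => (freqSymbol n k l * besselSymbol n (-s)) x * (𝓕 f : L2 n) x) (f : L2 n) :
    IntegrableOn (fun l => l ^ (s - 2 * k + 3) * ‖T l f‖ ^ 2) (Ioi 0) ∧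
      ∫ l in Ioi (0 : ℝ), l ^ (s - 2 * k + 3) * ‖T l f‖ ^ 2 =
        weightIntegral (s - 2 * k + 3) * ‖f‖ ^ 2 := by
  obtain ⟨p, hp⟩ : ∃ p : ℝ, p = s - 2 * k + 3 := ⟨_, rfl⟩
  rw [← hp]
  have hp0 : 0 ≤ p := by linarith
  have hp2 : p ≤ 2 := by linarith
  set F : L2 n := 𝓕 f with hF
  let G : ℝ → Space n → ℝ := fun l x =>
    l ^ p * (((l + (1 + ‖x‖ ^ 2)) ^ 4)⁻¹ * (1 + ‖x‖ ^ 2) ^ (3 - p)) * ‖F x‖ ^ 2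
  have hw : ∀ x : Space n, _ := fun x =>
    integral_scaled_weight hp0 hp2 (X := 1 + ‖x‖ ^ 2) (by positivity)
  have hGm : AEStronglyMeasurable (Function.uncurry G)
      ((volume.restrict (Ioi (0 : ℝ))).prod (volume : Measure (Space n))) := by
    have hFm : Measurable (F : Space n → ℂ) := (Lp.stronglyMeasurable F).measurable
    refine Measurable.aestronglyMeasurable ?_
    simp only [G, Function.uncurry_def]
    fun_prop
  have hGn : ∀ x : Space n, ∫ l in Ioi (0 : ℝ), ‖G l x‖ = weightIntegral p * ‖F x‖ ^ 2 := by
    intro x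
    rw [← (hw x).2, ← integral_mul_const]
    refine setIntegral_congr_fun measurableSet_Ioi fun l hl => ?_
    have hl' : (0 : ℝ) < l := hl
    exact Real.norm_of_nonneg (by positivity)
  -- Integrating in l first gives a constant multiple of |F|², so joint integrability follows and
  -- the order of integration may be exchanged.
  have hGi : Integrable (Function.uncurry G)
      ((volume.restrict (Ioi (0 : ℝ))).prod (volume : Measure (Space n))) := by
    rw [integrable_prod_iff' hGm]
    refine ⟨Eventually.of_forall fun x => ?_, ?_⟩
    · exact (hw x).1.mul_const (‖F x‖ ^ 2)
    · simp only [Function.uncurry_apply_pair, hGn]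
      exact (integrable_L2_norm_sq F).const_mul _
  have hGT : ∀ l ∈ Ioi (0 : ℝ), ∫ x, G l x = l ^ p * ‖T l f‖ ^ 2 := by
    intro l hl
    have hl' : (0 : ℝ) < l := hl
    rw [← Lp.norm_fourier_eq (T l f), L2_norm_sq_eq_integral, ← integral_const_mul]
    refine integral_congr_ae ?_
    filter_upwards [hT l hl'.le f] with x hx
    rw [hx, norm_mul, mul_pow, norm_sq_freqSymbol_mul n k s hl'.le, hp]
    simp only [G]
    rw [show 3 - p = 2 * k - s by rw [hp]; ring, hp]
    ring
  constructor
  · have h1 := hGi.integral_prod_left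
    exact (integrableOn_congr_fun hGT measurableSet_Ioi).1 h1
  · rw [← setIntegral_congr_fun measurableSet_Ioi hGT, integral_integral_swap hGi]
    have h2 : ∀ x, ∫ l in Ioi (0 : ℝ), G l x = weightIntegral p * ‖F x‖ ^ 2 := fun x => by
      rw [← (hw x).2, ← integral_mul_const]
    simp only [h2]
    rw [integral_const_mul, ← L2_norm_sq_eq_integral, hF, Lp.norm_fourier_eq]

/-- Here −3 ≤ s − 2k keeps the symbol bounded by 1. The operator exists for every real l, with value
0 for l < 0, so that a single family on ℝ can be chosen. -/
theorem exists_freqL2 (n : ℕ) {k : ℤ} {s : ℝ} (hk : -3 ≤ s - 2 * k) (l : ℝ) :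
    ∃ T : L2 n →L[ℂ] L2 n, 0 ≤ l →
      (∀ f, freqOp n k l (bessel n (-s) (toDist n f)) = toDist n (T f)) ∧
      ∀ f, ((𝓕 (T f) : L2 n) : Space n → ℂ) =ᵐ[volume]
        fun x => (freqSymbol n k l * besselSymbol n (-s)) x * (𝓕 f : L2 n) x := by
  rcases le_or_gt 0 l with hl | hl
  · have hm := freqSymbol_hasTemperateGrowth n k hl
    have hb : ∀ x, ‖(freqSymbol n k l * besselSymbol n (-s)) x‖ ≤ 1 := by
      intro x
      refine abs_le_one_iff_mul_self_le_one.2 ?_ |> (le_trans (le_abs_self _))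
      rw [← sq, norm_sq_freqSymbol_mul n k s hl, inv_mul_le_iff₀ (by positivity), mul_one]
      have h4 : ∀ X : ℝ, X ^ (4 : ℝ) = X ^ 4 := fun X => by exact_mod_cast Real.rpow_natCast X 4
      calc (1 + ‖x‖ ^ 2) ^ (2 * k - s) ≤ (1 + ‖x‖ ^ 2) ^ (4 : ℝ) :=
            Real.rpow_le_rpow_of_exponent_le (by nlinarith [sq_nonneg ‖x‖]) (by linarith)
        _ = (1 + ‖x‖ ^ 2) ^ 4 := h4 _
        _ ≤ _ := pow_le_pow_left₀ (by positivity) (by linarith) 4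
    obtain ⟨L, -, hL, hL'⟩ := exists_fourierL2
      (hm.mul (besselSymbol_hasTemperateGrowth n (-s))) hb
    refine ⟨L, fun _ => ⟨fun f => ?_, hL'⟩⟩
    rw [← hL, ← fourierOp_mul hm (by fun_prop), freqOp_eq n k hl]
    rfl
  · exact ⟨0, fun h => absurd h hl.not_ge⟩

theorem exists_sobolev_energy_bound {n : ℕ} {A : SecondOrderOp n} (hA : A.HasBInftyCoeffs)
    (hell : A.IsNegativeElliptic) (m2 s : ℝ) :
    ∃ C, 0 < C ∧ ∀ (ψ₀ ψ₁ : Dist n) (ψ ψt ψtt : ℝ → Dist n) (φ φ₁ χ : ℝ → L2 n),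
      IsEnergySolution A m2 s ψ₀ ψ₁ ψ ψt ψtt →
      (∀ t, 0 ≤ t → SobolevRep s (ψ t) (φ t)) →
      (∀ t, 0 ≤ t → SobolevRep (s + 1) (ψ t) (φ₁ t)) →
      (∀ t, 0 ≤ t → SobolevRep s (ψt t) (χ t)) →
      ∀ t, 0 ≤ t → ‖χ t‖ ^ 2 + Real.exp (-2 * t) * ‖φ₁ t‖ ^ 2 ≤
        C * (‖φ t‖ ^ 2 + Real.exp (-(n : ℝ) * t) * (‖χ 0‖ ^ 2 + ‖φ₁ 0‖ ^ 2)) := by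
  obtain ⟨k, hk0, hk1⟩ : ∃ k : ℤ, -3 ≤ s - 2 * k ∧ s - 2 * k ≤ -1 := by
    -- The admissible window for s − 2k has length 2, so some integer k fits. It makes p = s − 2k +
    -- 3 lie in [0, 2], where l^p(l+1)^{-4} is integrable.
    refine ⟨⌊(s + 3) / 2⌋, ?_, ?_⟩
    · linarith [Int.floor_le ((s + 3) / 2)]
    · linarith [Int.lt_floor_add_one ((s + 3) / 2)]
  obtain ⟨C, hC, h⟩ := exists_freq_energy_bound hA hell m2 s k hk0
  choose T hT using exists_freqL2 n (k := k) (s := s) hk0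
  refine ⟨C, hC, ?_⟩
  intro ψ₀ ψ₁ ψ ψt ψtt φ φ₁ χ hψ hφ hφ₁ hχ t ht
  have hI := integral_norm_sq_freq hk0 hk1 (T := T) fun l hl => (hT l hl).2
  have hpos := weightIntegral_pos (p := s - 2 * k + 3) (by linarith) (by linarith)
  set p := s - 2 * k + 3
  have hmono : ∫ l in Ioi (0 : ℝ), (l ^ p * ‖T l (χ t)‖ ^ 2 +
      Real.exp (-2 * t) * (l ^ p * ‖T l (φ₁ t)‖ ^ 2)) ≤
      ∫ l in Ioi (0 : ℝ), C * (l ^ p * ‖T l (φ t)‖ ^ 2 + Real.exp (-(n : ℝ) * t) *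
        (l ^ p * ‖T l (χ 0)‖ ^ 2 + l ^ p * ‖T l (φ₁ 0)‖ ^ 2)) := by
    refine setIntegral_mono_on ((hI _).1.add ((hI _).1.const_mul _))
      (((hI _).1.add (((hI _).1.add (hI _).1).const_mul _)).const_mul _) measurableSet_Ioi
      fun l hl => ?_
    have hl' : (0 : ℝ) < l := hl
    have h1 := h l (T l) hl'.le (hT l hl'.le).1 ψ₀ ψ₁ ψ ψt ψtt φ φ₁ χ hψ hφ hφ₁ hχ t ht
    have h2 := mul_le_mul_of_nonneg_left h1 (Real.rpow_pos_of_pos hl' p).le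
    linarith
  have h0 : ∫ l in Ioi (0 : ℝ), (l ^ p * ‖T l (χ 0)‖ ^ 2 + l ^ p * ‖T l (φ₁ 0)‖ ^ 2) =
      weightIntegral p * ‖χ 0‖ ^ 2 + weightIntegral p * ‖φ₁ 0‖ ^ 2 := by
    rw [integral_add (hI _).1 (hI _).1, (hI _).2, (hI _).2]
  have hi0 : IntegrableOn (fun l => Real.exp (-(n : ℝ) * t) *
      (l ^ p * ‖T l (χ 0)‖ ^ 2 + l ^ p * ‖T l (φ₁ 0)‖ ^ 2)) (Ioi 0) :=
    ((hI _).1.add (hI _).1).const_mul _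
  rw [integral_add (hI _).1 ((hI _).1.const_mul _), integral_const_mul, integral_const_mul,
    integral_add (hI _).1 hi0, integral_const_mul, h0, (hI _).2, (hI _).2, (hI _).2] at hmono
  refine le_of_mul_le_mul_left ?_ hpos
  linarith

theorem add_le_sqrt_mul_of_sq_add_sq_le {a b z x y C : ℝ} (hz : 0 ≤ z)
    (hx : 0 ≤ x) (hy : 0 ≤ y) (hC : 0 < C) (h : a ^ 2 + b ^ 2 ≤ C * (z ^ 2 + (x ^ 2 + y ^ 2))) :
    a + b ≤ Real.sqrt (2 * C) * (z + x + y) := by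
  refine le_of_sq_le_sq ?_ (by positivity)
  rw [mul_pow, Real.sq_sqrt (by positivity)]
  have h1 : z ^ 2 + (x ^ 2 + y ^ 2) ≤ (z + x + y) ^ 2 := by
    nlinarith [mul_nonneg hz hx, mul_nonneg hz hy, mul_nonneg hx hy]
  have h2 := mul_le_mul_of_nonneg_left h1 hC.le
  nlinarith [sq_nonneg (a - b)]

end DeSitterKG
end

/-! ### The estimate for norms, from its squared version. -/

theorem mainTheorem7 (n : ℕ) (hn : 1 ≤ n) (A : DeSitterKG.SecondOrderOp n)
    (hcoeff : A.HasBInftyCoeffs) (hell : A.IsNegativeElliptic) (m2 s : ℝ) :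
    ∃ C : ℝ, 0 < C ∧
      ∀ (ψ₀ ψ₁ : DeSitterKG.Dist n) (ψ ψt ψtt : ℝ → DeSitterKG.Dist n),
        DeSitterKG.IsEnergySolution A m2 s ψ₀ ψ₁ ψ ψt ψtt →
        ∀ t : ℝ, 0 < t →
          DeSitterKG.sobolevNorm s (ψt t)
              + Real.exp (-t) * DeSitterKG.sobolevNorm (s + 1) (ψ t)
            ≤ C * (DeSitterKG.sobolevNorm s (ψ t)
              + Real.exp (-(n : ℝ) / 2 * t) * DeSitterKG.sobolevNorm s ψ₁
              + Real.exp (-(n : ℝ) / 2 * t) * DeSitterKG.sobolevNorm (s + 1) ψ₀) := by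
  obtain ⟨C, hC, h⟩ := DeSitterKG.exists_sobolev_energy_bound hcoeff hell m2 s
  refine ⟨Real.sqrt (2 * C), by positivity, ?_⟩
  intro ψ₀ ψ₁ ψ ψt ψtt hψ t ht
  obtain ⟨φ₁, hφ₁, -⟩ := hψ.continuous
  obtain ⟨φ, χ, hφ, hχ, -⟩ := hψ.hasDeriv
  have key := h ψ₀ ψ₁ ψ ψt ψtt φ φ₁ χ hψ hφ hφ₁ hχ t ht.le
  rw [← hψ.initial, ← hψ.initial_deriv, (hχ t ht.le).sobolevNorm_eq,
    (hφ₁ t ht.le).sobolevNorm_eq, (hφ t ht.le).sobolevNorm_eq, (hχ 0 Set.self_mem_Ici).sobolevNorm_eq,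
    (hφ₁ 0 Set.self_mem_Ici).sobolevNorm_eq]
  refine DeSitterKG.add_le_sqrt_mul_of_sq_add_sq_le (norm_nonneg _) (by positivity)
    (by positivity) hC ?_
  have e1 : Real.exp (-t) ^ 2 = Real.exp (-2 * t) := by
    rw [← Real.exp_nat_mul]; congr 1; push_cast; ring
  have e2 : Real.exp (-(n : ℝ) / 2 * t) ^ 2 = Real.exp (-(n : ℝ) * t) := by
    rw [← Real.exp_nat_mul]; congr 1; push_cast; ring
  rw [mul_pow, mul_pow, mul_pow, e1, e2, ← mul_add]
  exact key
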